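/- Let $N\ge 3$ and let $\mathbb H^N$ be the $N$-dimensional hyperbolic space (complete, simply connected, constant sectional curvature $-1$), with geodesic distance $\mathrm d(\cdot,\cdot)$, Riemannian gradient $\nabla_{\mathbb H^N}$ and Riemannian volume $dv_{\mathbb H^N}$. For $N-2\le\lambda\le\left(\frac{N-1}{2}\right)^2$ put $\gamma_N(\lambda)=\sqrt{(N-1)^2-4\lambda}$, $$H_N(\lambda)=\frac{(\gamma_N(\lambda)+1)^2}{4},\quad D_N(\lambda)=\frac{\gamma_N(\lambda)(\gamma_N(\lambda)+1)}{2},\quad C_N(\lambda)=\frac{(N-1+\gamma_N(\lambda))(N-3-\gamma_N(\lambda))}{4},$$ let $g(r)=\frac{r\coth r-1}{r^2}$ for $r>0$, and for $x_0\in\mathbb H^N$ and $x\ne x_0$ let $$V_{\lambda,x_0}(x)=\frac{H_N(\lambda)}{\mathrm d(x,x_0)^2}+\frac{C_N(\lambda)}{\sinh^2(\mathrm d(x,x_0))}+D_N(\lambda)\,g(\mathrm d(x,x_0)).$$ For $d>0$ put $$K_N(\lambda,d)=\frac{H_N(\lambda)}{d^2}+\frac{C_N(\lambda)}{\sinh^2(d/2)}+D_N(\lambda)\,g(d/2).$$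 **Theorem.** Let $N\ge3$, $M\ge2$, let $y_1,\dots,y_M\in\mathbb H^N$ be distinct points and let $d=\min_{1\le j\ne k\le M}\frac{\mathrm d(y_j,y_k)}{2}>0$. Then for all $\lambda$ with $N-2\le\lambda\le\left(\frac{N-1}{2}\right)^2$ and all $u\in C_c^\infty(\mathbb H^N)$, $$\int_{\mathbb H^N}|\nabla_{\mathbb H^N}u|^2\,dv_{\mathbb H^N}+\left(\frac{\pi^2}{d^2}+(M+1)K_N(\lambda,d)-\lambda\right)\int_{\mathbb H^N}u^2\,dv_{\mathbb H^N}\ \ge\ \int_{\mathbb H^N}\sum_{k=1}^M V_{\lambda,y_k}(x)\,u^2\,dv_{\mathbb H^N},$$ where all the integrals are finite. -/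

import Mathlib

open MeasureTheory
open scoped ContDiff

noncomputable section

/-- The underlying set of the Poincare ball model of hyperbolic space `H^N`: the open unit ball of
`ℝ^N`. -/
def hypBall (N : ℕ) : Set (EuclideanSpace ℝ (Fin N)) := Metric.ball 0 1

/-- The hyperbolic metric tensor of constant sectional curvature `-1` on the unit ball,
`g_x(v, w) = 4 ⟨v, w⟩ / (1 - |x|^2)^2`. -/
def hypInner {N : ℕ} (x v w : EuclideanSpace ℝ (Fin N)) : ℝ :=
  (2 / (1 - ‖x‖ ^ 2)) ^ 2 * inner ℝ v w

/-- The Riemannian gradient `∇_{H^N} u = g⁻¹ du`. -/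
def hypGrad {N : ℕ} (u : EuclideanSpace ℝ (Fin N) → ℝ) (x : EuclideanSpace ℝ (Fin N)) :
    EuclideanSpace ℝ (Fin N) :=
  ((1 - ‖x‖ ^ 2) / 2) ^ 2 • gradient u x

/-- `hypGrad` is the gradient for the metric `hypInner`: it represents the differential. -/
theorem hypInner_hypGrad {N : ℕ} (u : EuclideanSpace ℝ (Fin N) → ℝ)
    {x : EuclideanSpace ℝ (Fin N)} (hx : x ∈ hypBall N) (v : EuclideanSpace ℝ (Fin N)) :
    hypInner x (hypGrad u x) v = fderiv ℝ u x v := by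
  have h1 : ‖x‖ < 1 := by simpa [hypBall] using hx
  have h2 : 1 - ‖x‖ ^ 2 ≠ 0 := by nlinarith [norm_nonneg x]
  rw [hypInner, hypGrad, real_inner_smul_left, gradient, InnerProductSpace.toDual_symm_apply]
  field_simp

/-- The squared Riemannian length `|∇_{H^N} u|^2` of the gradient. -/
def hypGradSq {N : ℕ} (u : EuclideanSpace ℝ (Fin N) → ℝ) (x : EuclideanSpace ℝ (Fin N)) : ℝ :=
  hypInner x (hypGrad u x) (hypGrad u x)

/-- The Riemannian volume measure `dv_{H^N} = √(det g) dx = (2 / (1 - |x|^2))^N dx` on the ball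
(and zero outside of the ball). -/
def hypVolume (N : ℕ) : Measure (EuclideanSpace ℝ (Fin N)) :=
  (volume.restrict (hypBall N)).withDensity
    (fun x => ENNReal.ofReal ((2 / (1 - ‖x‖ ^ 2)) ^ N))

/-- The hyperbolic (geodesic) distance in the Poincare ball model,
`cosh d(x, y) = 1 + 2 |x - y|^2 / ((1 - |x|^2) (1 - |y|^2))`. -/
def hypDist {N : ℕ} (x y : EuclideanSpace ℝ (Fin N)) : ℝ :=
  Real.arcosh (1 + 2 * ‖x - y‖ ^ 2 / ((1 - ‖x‖ ^ 2) * (1 - ‖y‖ ^ 2)))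

/-- `C_c^∞(H^N)`: smooth functions whose (compact) support lies in the open ball. -/
structure IsHypTestFunction {N : ℕ} (u : EuclideanSpace ℝ (Fin N) → ℝ) : Prop where
  smooth : ContDiff ℝ ∞ u
  compact_support : HasCompactSupport u
  support_subset : tsupport u ⊆ hypBall N

/-- `γ_N(λ) = √((N-1)^2 - 4λ)`. -/
def gammaN (N : ℕ) (lam : ℝ) : ℝ := Real.sqrt (((N : ℝ) - 1) ^ 2 - 4 * lam)

/-- `H_N(λ) = (γ_N(λ) + 1)^2 / 4`. -/
def constH (N : ℕ) (lam : ℝ) : ℝ := (gammaN N lam + 1) ^ 2 / 4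

/-- `D_N(λ) = γ_N(λ) (γ_N(λ) + 1) / 2`. -/
def constD (N : ℕ) (lam : ℝ) : ℝ := gammaN N lam * (gammaN N lam + 1) / 2

/-- `C_N(λ) = (N - 1 + γ_N(λ)) (N - 3 - γ_N(λ)) / 4`. -/
def constC (N : ℕ) (lam : ℝ) : ℝ :=
  ((N : ℝ) - 1 + gammaN N lam) * ((N : ℝ) - 3 - gammaN N lam) / 4

/-- `g(r) = (r coth r - 1) / r^2` for `r > 0`. -/
def gFun (r : ℝ) : ℝ := (r * (Real.cosh r / Real.sinh r) - 1) / r ^ 2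

/-- The unipolar potential `V_{λ,x₀}`; its value at the pole `x₀` itself plays no role. -/
def potV (N : ℕ) (lam : ℝ) (x₀ x : EuclideanSpace ℝ (Fin N)) : ℝ :=
  constH N lam * (1 / hypDist x x₀ ^ 2) + constC N lam * (1 / Real.sinh (hypDist x x₀) ^ 2)
    + constD N lam * gFun (hypDist x x₀)

/-- The multipolar potential `V_{λ,y_1,…,y_M} = ∑_k V_{λ,y_k}`. -/
def multiPotV {M : ℕ} (N : ℕ) (lam : ℝ) (y : Fin M → EuclideanSpace ℝ (Fin N))
    (x : EuclideanSpace ℝ (Fin N)) : ℝ :=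
  ∑ k, potV N lam (y k) x

/-- `d = min_{j ≠ k} d(y_j, y_k) / 2` (a minimum over a finite set of pairs, nonempty for
`M ≥ 2`). -/
def halfMinDist {N M : ℕ} (y : Fin M → EuclideanSpace ℝ (Fin N)) : ℝ :=
  ⨅ p : {p : Fin M × Fin M // p.1 ≠ p.2}, hypDist (y p.1.1) (y p.1.2) / 2

/-- `K_N(λ,d) = H_N(λ) / d^2 + C_N(λ) / sinh^2(d/2) + D_N(λ) g(d/2)`. -/
def constK (N : ℕ) (lam d : ℝ) : ℝ :=
  constH N lam * (1 / d ^ 2) + constC N lam * (1 / Real.sinh (d / 2) ^ 2)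
    + constD N lam * gFun (d / 2)

end

/-! The argument is the supersolution method in vector-field form. If `div F - |F|² ≥ R` on
hyperbolic space, integrating `|∇u + uF|² ≥ 0` gives `∫ |∇u|² ≥ ∫ R u²`
(`IsHypTestFunction.exists_majorant`). In the ball, a hyperbolic field times the conformal factor to
the power `N - 2` (for Euclidean gradient components) becomes a flux whose Euclidean divergence is
the weighted hyperbolic one, so only the Euclidean divergence theorem is needed.

For one pole, take `F = -∇ log φ` with the ground state `φ = r ^ a / sinh ^ b r`; a Riccati identity
(`groundField_riccati`) gives exactly `div F - |F|² = λ + V`.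

For several poles, the unipolar fields are glued by cutoffs `p_k` supported in the disjoint balls of
radius `d` around the poles. Gluing fields convexly produces the error `⟨∇p, F_k - F_1⟩`, while
strict convexity of the square leaves the gain `p(1 - p)|F_k - F_1|²`. The gain absorbs the error at
cost `|∇p|² / (4p(1 - p))`, and `p = sin²(πr/d)` on the transition annulus makes this cost the
constant `π²/d²` (`ims_localization_le`, `multiLower_le_euclDiv`).

The potential lost in gluing is at most `∑ (1 - p_k) V_k ≤ (M + 1) K`: each far pole costs `K`, and
a pole at distance less than `d` costs `2K` (`sum_one_sub_polePart_mul_le`).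

The fields are singular at the poles. They are first cut off at scale `ε`, which preserves the
Riccati inequality (`truncProfile_riccati`), and Fatou's lemma then removes the truncation. -/

/-- The Euclidean divergence of a vector field. -/
noncomputable def euclDiv {N : ℕ} (G : EuclideanSpace ℝ (Fin N) → EuclideanSpace ℝ (Fin N))
    (x : EuclideanSpace ℝ (Fin N)) : ℝ :=
  ∑ i, fderiv ℝ G x (EuclideanSpace.single i 1) i

/-! ### Euclidean divergence and the divergence theorem. -/

section Divergence

variable {N : ℕ} {G F : EuclideanSpace ℝ (Fin N) → EuclideanSpace ℝ (Fin N)}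
  {x : EuclideanSpace ℝ (Fin N)}

theorem sum_inner_single_mul (v w : EuclideanSpace ℝ (Fin N)) :
    ∑ i, inner ℝ v (EuclideanSpace.single i 1) * w i = inner ℝ v w := by
  simp only [PiLp.inner_apply]
  simp [mul_comm]

theorem integrable_euclDiv (hG : ContDiff ℝ 1 G) (hc : HasCompactSupport G) :
    Integrable (euclDiv G) := by
  unfold euclDiv
  refine integrable_finsetSum _ fun i _ => ?_
  have h1 : Continuous fun x => fderiv ℝ G x (EuclideanSpace.single i 1) :=
    (hG.continuous_fderiv one_ne_zero).clm_apply continuous_const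
  have h2 : HasCompactSupport fun x => fderiv ℝ G x (EuclideanSpace.single i 1) :=
    (hc.fderiv (𝕜 := ℝ)).comp_left (g := fun L : EuclideanSpace ℝ (Fin N) →L[ℝ] EuclideanSpace ℝ (Fin N) =>
        L (EuclideanSpace.single i 1)) (by simp)
  exact (EuclideanSpace.proj (𝕜 := ℝ) i).integrable_comp (h1.integrable_of_hasCompactSupport h2)

theorem integral_euclDiv_eq_zero (hG : ContDiff ℝ 1 G) (hc : HasCompactSupport G) :
    ∫ x, euclDiv G x = 0 := by
  unfold euclDiv
  have h1 : ∀ i : Fin N, Continuous fun x => fderiv ℝ G x (EuclideanSpace.single i 1) := fun i =>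
    (hG.continuous_fderiv one_ne_zero).clm_apply continuous_const
  have h2 : ∀ i : Fin N, Integrable fun x => fderiv ℝ G x (EuclideanSpace.single i 1) := fun i =>
    (h1 i).integrable_of_hasCompactSupport
      ((hc.fderiv (𝕜 := ℝ)).comp_left (g := fun L : EuclideanSpace ℝ (Fin N) →L[ℝ] EuclideanSpace ℝ (Fin N) =>
        L (EuclideanSpace.single i 1)) (by simp))
  rw [integral_finsetSum _ fun i _ => by
    simpa using (EuclideanSpace.proj (𝕜 := ℝ) i).integrable_comp (h2 i)]
  refine Finset.sum_eq_zero fun i _ => ?_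
  have h3 := (EuclideanSpace.proj (𝕜 := ℝ) i).integral_comp_comm (h2 i)
  -- Integration by parts against the constant function `1`, whose derivative vanishes.
  have h4 := integral_smul_fderiv_eq_neg_fderiv_smul_of_integrable (μ := volume)
    (f := fun _ : EuclideanSpace ℝ (Fin N) => (1 : ℝ)) (g := G) (v := EuclideanSpace.single i 1)
    (by simp) (by simpa using h2 i)
    (by simpa using hG.continuous.integrable_of_hasCompactSupport hc)
    (fun x _ => differentiableAt_const _) (fun x _ => hG.differentiable one_ne_zero x)
  simp only [one_smul, fderiv_fun_const, Pi.zero_apply, zero_apply, zero_smul,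
    integral_zero, neg_zero] at h4
  rw [h4] at h3
  simpa using h3

theorem euclDiv_smul {h : EuclideanSpace ℝ (Fin N) → ℝ} {v : EuclideanSpace ℝ (Fin N)}
    (hh : HasGradientAt h v x) (hG : DifferentiableAt ℝ G x) :
    euclDiv (fun z => h z • G z) x = inner ℝ v (G x) + h x * euclDiv G x := by
  have h1 := (hh.hasFDerivAt.smul hG.hasFDerivAt).fderiv
  unfold euclDiv
  rw [show (fun z => h z • G z) = h • G from rfl, h1, Finset.mul_sum, ← sum_inner_single_mul,
    ← Finset.sum_add_distrib]
  refine Finset.sum_congr rfl fun i _ => ?_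
  simp [add_comm]

theorem euclDiv_add (hF : DifferentiableAt ℝ F x) (hG : DifferentiableAt ℝ G x) :
    euclDiv (fun z => F z + G z) x = euclDiv F x + euclDiv G x := by
  unfold euclDiv
  rw [fderiv_fun_add hF hG, ← Finset.sum_add_distrib]
  simp

theorem euclDiv_sub (hF : DifferentiableAt ℝ F x) (hG : DifferentiableAt ℝ G x) :
    euclDiv (fun z => F z - G z) x = euclDiv F x - euclDiv G x := by
  unfold euclDiv
  rw [fderiv_fun_sub hF hG, ← Finset.sum_sub_distrib]
  simp

theorem euclDiv_sum {ι : Type*} [Fintype ι]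
    {A : ι → EuclideanSpace ℝ (Fin N) → EuclideanSpace ℝ (Fin N)}
    (hA : ∀ k, DifferentiableAt ℝ (A k) x) :
    euclDiv (fun z => ∑ k, A k z) x = ∑ k, euclDiv (A k) x := by
  unfold euclDiv
  rw [fderiv_fun_sum fun k _ => hA k, Finset.sum_comm]
  simp

theorem euclDiv_sub_const (y : EuclideanSpace ℝ (Fin N)) :
    euclDiv (fun z => z - y) x = N := by
  unfold euclDiv
  rw [fderiv_sub_const]
  simp

theorem euclDiv_id : euclDiv (fun z => z) x = N := by
  simpa using euclDiv_sub_const (x := x) 0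

end Divergence

/-! ### Calculus rules for Euclidean gradients. -/

section Gradients

variable {N : ℕ} {x : EuclideanSpace ℝ (Fin N)}

theorem HasGradientAt.comp_hasDerivAt {h : EuclideanSpace ℝ (Fin N) → ℝ}
    {v : EuclideanSpace ℝ (Fin N)} {f : ℝ → ℝ} {f' : ℝ} (hf : HasDerivAt f f' (h x))
    (hh : HasGradientAt h v x) : HasGradientAt (fun z => f (h z)) (f' • v) x := by
  rw [hasGradientAt_iff_hasFDerivAt]
  refine (hf.comp_hasFDerivAt x hh.hasFDerivAt).congr_fderiv ?_
  ext z; simp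

theorem HasGradientAt.mul_real {h k : EuclideanSpace ℝ (Fin N) → ℝ}
    {v w : EuclideanSpace ℝ (Fin N)} (hh : HasGradientAt h v x) (hk : HasGradientAt k w x) :
    HasGradientAt (fun z => h z * k z) (h x • w + k x • v) x := by
  rw [hasGradientAt_iff_hasFDerivAt]
  refine (hh.hasFDerivAt.mul hk.hasFDerivAt).congr_fderiv ?_
  ext z; simp

theorem hasGradientAt_norm_sub_sq (y : EuclideanSpace ℝ (Fin N)) :
    HasGradientAt (fun z => ‖z - y‖ ^ 2) ((2 : ℝ) • (x - y)) x := by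
  rw [hasGradientAt_iff_hasFDerivAt]
  refine ((hasFDerivAt_id x).sub_const y).norm_sq.congr_fderiv ?_
  ext z; simp

theorem hasGradientAt_one_sub_norm_sq :
    HasGradientAt (fun z : EuclideanSpace ℝ (Fin N) => 1 - ‖z‖ ^ 2) ((-2 : ℝ) • x) x := by
  rw [hasGradientAt_iff_hasFDerivAt]
  refine ((hasFDerivAt_id x).norm_sq.const_sub 1).congr_fderiv ?_
  ext z; simp

end Gradients

/-! ### Gradient and Laplacian of the hyperbolic cosine of the distance. -/

/-- `cosh` of the hyperbolic distance to `y`. -/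
noncomputable def coshDist {N : ℕ} (y x : EuclideanSpace ℝ (Fin N)) : ℝ :=
  1 + 2 * ‖x - y‖ ^ 2 / ((1 - ‖x‖ ^ 2) * (1 - ‖y‖ ^ 2))

/-- The Euclidean gradient of `coshDist y`. -/
noncomputable def gradCoshDist {N : ℕ} (y x : EuclideanSpace ℝ (Fin N)) :
    EuclideanSpace ℝ (Fin N) :=
  (4 / ((1 - ‖y‖ ^ 2) * (1 - ‖x‖ ^ 2) ^ 2)) • ((1 - ‖x‖ ^ 2) • (x - y) + ‖x - y‖ ^ 2 • x)

/-- The conformal factor of the Poincare metric. -/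
noncomputable def confFactor {N : ℕ} (x : EuclideanSpace ℝ (Fin N)) : ℝ := 2 / (1 - ‖x‖ ^ 2)

section Ball

variable {N : ℕ} {x y : EuclideanSpace ℝ (Fin N)}

theorem one_sub_norm_sq_pos (hx : x ∈ hypBall N) : 0 < 1 - ‖x‖ ^ 2 := by
  have h1 : ‖x‖ < 1 := by simpa [hypBall] using hx
  nlinarith [norm_nonneg x]

theorem isOpen_hypBall : IsOpen (hypBall N) := Metric.isOpen_ball

theorem confFactor_pos (hx : x ∈ hypBall N) : 0 < confFactor x :=
  div_pos two_pos (one_sub_norm_sq_pos hx)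

theorem one_le_coshDist (hy : y ∈ hypBall N) (hx : x ∈ hypBall N) : 1 ≤ coshDist y x := by
  have h1 := one_sub_norm_sq_pos hx
  have h2 := one_sub_norm_sq_pos hy
  have : 0 ≤ 2 * ‖x - y‖ ^ 2 / ((1 - ‖x‖ ^ 2) * (1 - ‖y‖ ^ 2)) := by positivity
  unfold coshDist; linarith

theorem coshDist_eq_one_iff (hy : y ∈ hypBall N) (hx : x ∈ hypBall N) :
    coshDist y x = 1 ↔ x = y := by
  have h1 := one_sub_norm_sq_pos hx
  have h2 := one_sub_norm_sq_pos hy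
  unfold coshDist
  constructor
  · intro h
    have h3 : 2 * ‖x - y‖ ^ 2 / ((1 - ‖x‖ ^ 2) * (1 - ‖y‖ ^ 2)) = 0 := by linarith
    rw [div_eq_zero_iff] at h3
    rcases h3 with h3 | h3
    · simpa [sub_eq_zero] using h3
    · exact absurd h3 (mul_pos h1 h2).ne'
  · rintro rfl; simp

theorem inner_self_sub_eq (x y : EuclideanSpace ℝ (Fin N)) :
    inner ℝ x (x - y) = (‖x‖ ^ 2 + ‖x - y‖ ^ 2 - ‖y‖ ^ 2) / 2 := by
  have h := norm_sub_sq_real x y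
  rw [inner_sub_right, real_inner_self_eq_norm_sq]
  linarith

theorem hasGradientAt_coshDist (hy : y ∈ hypBall N) (hx : x ∈ hypBall N) :
    HasGradientAt (coshDist y) (gradCoshDist y x) x := by
  have h1 := one_sub_norm_sq_pos hx
  have h2 := one_sub_norm_sq_pos hy
  have hinv : HasDerivAt (fun t : ℝ => 1 + 2 / (1 - ‖y‖ ^ 2) * t) (2 / (1 - ‖y‖ ^ 2))
      (‖x - y‖ ^ 2 * (1 - ‖x‖ ^ 2)⁻¹) := by
    have h := (hasDerivAt_id' (‖x - y‖ ^ 2 * (1 - ‖x‖ ^ 2)⁻¹)).const_mul (2 / (1 - ‖y‖ ^ 2))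
    exact (h.const_add 1).congr_deriv (mul_one _)
  have h3 := HasGradientAt.comp_hasDerivAt (h := fun z => 1 - ‖z‖ ^ 2) (x := x)
    (hasDerivAt_inv h1.ne') hasGradientAt_one_sub_norm_sq
  have h4 := HasGradientAt.comp_hasDerivAt hinv ((hasGradientAt_norm_sub_sq y).mul_real h3)
  have h5 : coshDist y =
      fun z => 1 + 2 / (1 - ‖y‖ ^ 2) * (‖z - y‖ ^ 2 * (1 - ‖z‖ ^ 2)⁻¹) := by
    funext z
    simp only [coshDist, div_eq_mul_inv, mul_inv]
    ring
  rw [h5]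
  convert h4 using 1
  unfold gradCoshDist
  simp only [smul_add, smul_smul]
  rw [add_comm]
  congr 2 <;> field_simp <;> ring

/-- The eikonal equation `|∇r| = 1` in disguise: the right side is the squared conformal factor
times `sinh² r`. -/
theorem norm_gradCoshDist_sq (hy : y ∈ hypBall N) (hx : x ∈ hypBall N) :
    ‖gradCoshDist y x‖ ^ 2 = confFactor x ^ 2 * (coshDist y x ^ 2 - 1) := by
  have h1 := one_sub_norm_sq_pos hx
  have h2 := one_sub_norm_sq_pos hy
  have h3 := inner_self_sub_eq x y
  unfold gradCoshDist confFactor coshDist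
  rw [norm_smul, mul_pow, norm_add_sq_real, norm_smul, norm_smul, inner_smul_left,
    inner_smul_right, real_inner_comm, h3]
  simp only [Real.norm_eq_abs, mul_pow, sq_abs, conj_trivial]
  generalize ‖x - y‖ = q at *
  set m := 1 - ‖x‖ ^ 2 with hm
  set c := 1 - ‖y‖ ^ 2 with hc
  have e1 : ‖x‖ ^ 2 = 1 - m := by rw [hm]; ring
  have e2 : ‖y‖ ^ 2 = 1 - c := by rw [hc]; ring
  rw [e1, e2]
  field_simp
  ring

/-- This is `Δ cosh r = N cosh r` on hyperbolic space, since `div (ρ ^ (N - 2) ∇h) = ρ ^ N Δh` for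
the conformal factor `ρ`. Working with `cosh r` rather than `r` avoids the singularity at the pole.
-/
theorem euclDiv_weight_gradCoshDist (hN : 2 ≤ N) (hy : y ∈ hypBall N) (hx : x ∈ hypBall N) :
    euclDiv (fun z => confFactor z ^ (N - 2) • gradCoshDist y z) x
      = N * confFactor x ^ N * coshDist y x := by
  have h1 := one_sub_norm_sq_pos hx
  have h2 := one_sub_norm_sq_pos hy
  have h3 := inner_self_sub_eq x y
  obtain ⟨n, rfl⟩ := Nat.exists_eq_add_of_le hN
  have e : (fun z : EuclideanSpace ℝ (Fin (2 + n)) =>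
      confFactor z ^ (2 + n - 2) • gradCoshDist y z)
      = fun z => (2 ^ (2 + n) / (1 - ‖y‖ ^ 2) * ((1 - ‖z‖ ^ 2)⁻¹) ^ (2 + n)) •
        ((1 - ‖z‖ ^ 2) • (z - y) + ‖z - y‖ ^ 2 • z) := by
    funext z
    unfold confFactor gradCoshDist
    rw [smul_smul]
    congr 1
    rw [show 2 + n - 2 = n by omega]
    simp only [div_eq_mul_inv, mul_inv, mul_pow, inv_pow, pow_add]
    ring
  have g0 := HasGradientAt.comp_hasDerivAt (h := fun z => 1 - ‖z‖ ^ 2) (x := x)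
    (hasDerivAt_inv h1.ne') hasGradientAt_one_sub_norm_sq
  have g1 := HasGradientAt.comp_hasDerivAt (h := fun z => (1 - ‖z‖ ^ 2)⁻¹) (x := x)
    (((hasDerivAt_pow (2 + n) ((1 - ‖x‖ ^ 2)⁻¹))).const_mul (2 ^ (2 + n) / (1 - ‖y‖ ^ 2))) g0
  have dA : DifferentiableAt ℝ (fun z : EuclideanSpace ℝ (Fin (2 + n)) => z - y) x := by fun_prop
  have dB : DifferentiableAt ℝ (fun z : EuclideanSpace ℝ (Fin (2 + n)) => z) x := by fun_prop
  have d1 := (hasGradientAt_one_sub_norm_sq (x := x)).differentiableAt.fun_smul dA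
  have d2 := (hasGradientAt_norm_sub_sq (x := x) y).differentiableAt.fun_smul dB
  rw [e, euclDiv_smul g1 (d1.fun_add d2), euclDiv_add d1 d2,
    euclDiv_smul hasGradientAt_one_sub_norm_sq dA, euclDiv_smul (hasGradientAt_norm_sub_sq y) dB,
    euclDiv_sub_const, euclDiv_id]
  simp only [inner_smul_left, inner_add_right, inner_smul_right, conj_trivial,
    real_inner_comm x (x - y), real_inner_self_eq_norm_sq, h3]
  rw [show 2 + n - 1 = n + 1 by omega]
  unfold confFactor coshDist
  generalize ‖x - y‖ = q at *
  set m := 1 - ‖x‖ ^ 2 with hm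
  set c := 1 - ‖y‖ ^ 2 with hc
  have e1 : ‖x‖ ^ 2 = 1 - m := by rw [hm]; ring
  have e2 : ‖y‖ ^ 2 = 1 - c := by rw [hc]; ring
  rw [e1, e2]
  push_cast
  simp only [inv_pow, div_pow]
  field_simp
  ring

end Ball

/-! ### Triangle inequality through the hyperboloid model. -/

section Triangle

/-- For points `P_i = (t_i, s_i)` of the hyperboloid, the components of `P_1` and `P_3`
Lorentz-orthogonal to `P_2` lie in a subspace on which the Lorentz form is nonnegative. The claim is
Cauchy-Schwarz there, read off from the discriminant. -/
theorem lorentz_cauchy_schwarz {E : Type*} [NormedAddCommGroup E] [InnerProductSpace ℝ E]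
    {s₁ s₂ s₃ : E} {t₁ t₂ t₃ : ℝ} (h₁ : t₁ ^ 2 = 1 + ‖s₁‖ ^ 2) (h₂ : t₂ ^ 2 = 1 + ‖s₂‖ ^ 2)
    (h₃ : t₃ ^ 2 = 1 + ‖s₃‖ ^ 2) :
    ((t₁ * t₂ - inner ℝ s₁ s₂) * (t₂ * t₃ - inner ℝ s₂ s₃) - (t₁ * t₃ - inner ℝ s₁ s₃)) ^ 2 ≤
      ((t₁ * t₂ - inner ℝ s₁ s₂) ^ 2 - 1) * ((t₂ * t₃ - inner ℝ s₂ s₃) ^ 2 - 1) := by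
  have key : ∀ τ : ℝ, 0 ≤ ((t₂ * t₃ - inner ℝ s₂ s₃) ^ 2 - 1) * (τ * τ)
      + 2 * ((t₁ * t₂ - inner ℝ s₁ s₂) * (t₂ * t₃ - inner ℝ s₂ s₃)
        - (t₁ * t₃ - inner ℝ s₁ s₃)) * τ + ((t₁ * t₂ - inner ℝ s₁ s₂) ^ 2 - 1) := by
    intro τ
    set A := t₁ * t₂ - inner ℝ s₁ s₂ with hA
    set B := t₂ * t₃ - inner ℝ s₂ s₃ with hB
    set w : E := (s₁ - A • s₂) + τ • (s₃ - B • s₂) with hw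
    set w₀ : ℝ := (t₁ - A * t₂) + τ * (t₃ - B * t₂) with hw₀
    have e₁₂ : inner ℝ s₁ s₂ = t₁ * t₂ - A := by rw [hA]; ring
    have e₂₃ : inner ℝ s₂ s₃ = t₂ * t₃ - B := by rw [hB]; ring
    have e₃₂ : inner ℝ s₃ s₂ = t₂ * t₃ - B := by rw [real_inner_comm, e₂₃]
    have e₂₁ : inner ℝ s₂ s₁ = t₁ * t₂ - A := by rw [real_inner_comm, e₁₂]
    have hn₁ : ‖s₁‖ ^ 2 = t₁ ^ 2 - 1 := by linarith
    have hn₂ : ‖s₂‖ ^ 2 = t₂ ^ 2 - 1 := by linarith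
    have hn₃ : ‖s₃‖ ^ 2 = t₃ ^ 2 - 1 := by linarith
    have horth : inner ℝ s₂ w = t₂ * w₀ := by
      rw [hw, hw₀]
      simp only [inner_add_right, inner_sub_right, inner_smul_right, real_inner_self_eq_norm_sq,
        e₂₁, e₂₃, hn₂]
      ring
    have hwn : ‖w‖ ^ 2 = (B ^ 2 - 1) * (τ * τ)
        + 2 * (A * B - (t₁ * t₃ - inner ℝ s₁ s₃)) * τ + (A ^ 2 - 1) + w₀ ^ 2 := by
      rw [← real_inner_self_eq_norm_sq, hw, hw₀]
      simp only [inner_add_right, inner_sub_right, inner_smul_right, inner_add_left,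
        inner_sub_left, inner_smul_left, real_inner_self_eq_norm_sq, conj_trivial,
        e₂₁, e₂₃, e₁₂, e₃₂, hn₁, hn₂, hn₃, real_inner_comm s₁ s₃]
      ring
    have hcs : (inner ℝ s₂ w) ^ 2 ≤ ‖s₂‖ ^ 2 * ‖w‖ ^ 2 := by
      rw [← mul_pow]
      exact sq_le_sq.2 (by
        rw [abs_of_nonneg (a := ‖s₂‖ * ‖w‖) (by positivity)]; exact abs_real_inner_le_norm _ _)
    rw [horth, hn₂] at hcs
    have h2 : 1 ≤ t₂ ^ 2 := by rw [h₂]; nlinarith [sq_nonneg ‖s₂‖]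
    -- If instead `‖w‖² < w₀²`, then `t₂² w₀² ≤ (t₂² - 1)‖w‖² ≤ (t₂² - 1) w₀²` would force `w₀ = 0`.
    have h5 : w₀ ^ 2 ≤ ‖w‖ ^ 2 := by
      by_contra hcon
      push Not at hcon
      nlinarith [sq_nonneg ‖w‖]
    linarith
  have h := discrim_le_zero key
  rw [discrim] at h
  linarith

variable {N : ℕ} {x y z : EuclideanSpace ℝ (Fin N)}

theorem coshDist_eq_lorentz (hx : x ∈ hypBall N) (hy : y ∈ hypBall N) :
    coshDist y x = (1 + ‖x‖ ^ 2) / (1 - ‖x‖ ^ 2) * ((1 + ‖y‖ ^ 2) / (1 - ‖y‖ ^ 2))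
      - inner ℝ ((2 / (1 - ‖x‖ ^ 2)) • x) ((2 / (1 - ‖y‖ ^ 2)) • y) := by
  have h1 := one_sub_norm_sq_pos hx
  have h2 := one_sub_norm_sq_pos hy
  rw [coshDist, norm_sub_sq_real, inner_smul_left, inner_smul_right]
  simp only [conj_trivial]
  field_simp
  ring

theorem lorentz_time_sq (hx : x ∈ hypBall N) :
    ((1 + ‖x‖ ^ 2) / (1 - ‖x‖ ^ 2)) ^ 2 = 1 + ‖(2 / (1 - ‖x‖ ^ 2)) • x‖ ^ 2 := by
  have h1 := one_sub_norm_sq_pos hx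
  rw [norm_smul, mul_pow, Real.norm_eq_abs, sq_abs]
  field_simp
  ring

theorem cosh_hypDist (hx : x ∈ hypBall N) (hy : y ∈ hypBall N) :
    Real.cosh (hypDist x y) = coshDist y x :=
  Real.cosh_arcosh (one_le_coshDist hy hx)

theorem hypDist_nonneg (hx : x ∈ hypBall N) (hy : y ∈ hypBall N) : 0 ≤ hypDist x y :=
  Real.arcosh_nonneg (one_le_coshDist hy hx)

theorem hypDist_comm (x y : EuclideanSpace ℝ (Fin N)) : hypDist x y = hypDist y x := by
  rw [hypDist, hypDist, norm_sub_rev, mul_comm (1 - ‖x‖ ^ 2)]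

theorem hypDist_pos (hx : x ∈ hypBall N) (hy : y ∈ hypBall N) (hxy : x ≠ y) :
    0 < hypDist x y :=
  Real.arcosh_pos (lt_of_le_of_ne (one_le_coshDist hy hx)
    fun h => hxy ((coshDist_eq_one_iff hy hx).1 h.symm))

theorem hypDist_triangle (hx : x ∈ hypBall N) (hy : y ∈ hypBall N) (hz : z ∈ hypBall N) :
    hypDist x z ≤ hypDist x y + hypDist y z := by
  have h0 := lorentz_cauchy_schwarz (lorentz_time_sq hx) (lorentz_time_sq hy) (lorentz_time_sq hz)
  rw [← coshDist_eq_lorentz hx hy, ← coshDist_eq_lorentz hy hz, ← coshDist_eq_lorentz hx hz,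
    ← cosh_hypDist hx hy, ← cosh_hypDist hy hz, ← cosh_hypDist hx hz] at h0
  have n1 := hypDist_nonneg hx hy
  have n2 := hypDist_nonneg hy hz
  have s1 := Real.sinh_nonneg_iff.2 n1
  have s2 := Real.sinh_nonneg_iff.2 n2
  -- The Lorentz inequality says `|cosh a cosh b - cosh c| ≤ sinh a sinh b`, hence `cosh c ≤ cosh (a
  -- + b)`.
  have h3 : Real.cosh (hypDist x z) ≤ Real.cosh (hypDist x y + hypDist y z) := by
    rw [Real.cosh_add]
    rw [Real.cosh_sq (hypDist x y), Real.cosh_sq (hypDist y z), add_sub_cancel_right,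
      add_sub_cancel_right, ← mul_pow] at h0
    have := abs_le.1 (abs_le_of_sq_le_sq h0 (mul_nonneg s1 s2))
    linarith [this.1, this.2]
  rwa [Real.cosh_le_cosh, abs_of_nonneg (hypDist_nonneg hx hz), abs_of_nonneg (by positivity)]
    at h3

end Triangle

/-! ### One-variable hyperbolic inequalities. -/

section Hyperbolic

theorem nonneg_of_hasDerivAt_nonneg {f f' : ℝ → ℝ} (hf : ∀ x, HasDerivAt f (f' x) x)
    (h0 : f 0 = 0) (hf' : ∀ x, 0 ≤ x → 0 ≤ f' x) {x : ℝ} (hx : 0 ≤ x) : 0 ≤ f x := by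
  have hm : MonotoneOn f (Set.Ici 0) := by
    refine monotoneOn_of_deriv_nonneg (convex_Ici 0)
      (fun z _ => (hf z).continuousAt.continuousWithinAt)
      (fun z _ => (hf z).differentiableAt.differentiableWithinAt) fun z hz => ?_
    rw [interior_Ici] at hz
    rw [(hf z).deriv]
    exact hf' z (le_of_lt hz)
  simpa [h0] using hm (Set.mem_Ici.2 le_rfl) hx hx

theorem sinh_le_mul_cosh {r : ℝ} (hr : 0 ≤ r) : Real.sinh r ≤ r * Real.cosh r := by
  have := nonneg_of_hasDerivAt_nonneg (f := fun r => r * Real.cosh r - Real.sinh r)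
    (f' := fun r => r * Real.sinh r)
    (fun x => (((hasDerivAt_id' x).mul (Real.hasDerivAt_cosh x)).sub
      (Real.hasDerivAt_sinh x)).congr_deriv (by ring)) (by simp)
    (fun x hx => mul_nonneg hx (Real.sinh_nonneg_iff.2 hx)) hr
  linarith

/-- Differentiating the difference twice gives `4 sinh x (x cosh x - sinh x) ≥ 0`, and the
difference and its first derivative vanish at `0`. This is the sign needed for the derivative of
`gFun`. -/
theorem two_mul_sinh_sq_le {r : ℝ} (hr : 0 ≤ r) :
    2 * Real.sinh r ^ 2 ≤ r * (Real.sinh r * Real.cosh r) + r ^ 2 := by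
  have h2 : ∀ x : ℝ, 0 ≤ x → 0 ≤ 2 * (x * (Real.cosh x ^ 2 + Real.sinh x ^ 2))
      - 2 * (Real.sinh x * Real.cosh x) := fun x hx => by
    have h := sinh_le_mul_cosh hx
    have h' := Real.cosh_pos x
    have h'' : Real.sinh x * Real.cosh x ≤ x * Real.cosh x * Real.cosh x :=
      mul_le_mul_of_nonneg_right h h'.le
    nlinarith [mul_nonneg hx (sq_nonneg (Real.sinh x))]
  have h1 : ∀ x : ℝ, 0 ≤ x → 0 ≤ x * (Real.cosh x ^ 2 + Real.sinh x ^ 2) + 2 * x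
      - 3 * (Real.sinh x * Real.cosh x) := fun x hx => by
    refine nonneg_of_hasDerivAt_nonneg (f := fun x => x * (Real.cosh x ^ 2 + Real.sinh x ^ 2)
      + 2 * x - 3 * (Real.sinh x * Real.cosh x)) (f' := fun x =>
        4 * Real.sinh x * (x * Real.cosh x - Real.sinh x)) (fun x => ?_) (by simp)
        (fun x hx => ?_) hx
    · have hc := Real.hasDerivAt_cosh x
      have hs := Real.hasDerivAt_sinh x
      refine ((((hasDerivAt_id' x).mul ((hc.pow 2).add (hs.pow 2))).add
        ((hasDerivAt_id' x).const_mul 2)).sub ((hs.mul hc).const_mul 3)).congr_deriv ?_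
      have := Real.cosh_sq x
      simp only [Pi.add_apply, Pi.pow_apply]
      push_cast
      linear_combination (-2) * this
    · exact mul_nonneg (mul_nonneg (by norm_num) (Real.sinh_nonneg_iff.2 hx))
        (sub_nonneg.2 (sinh_le_mul_cosh hx))
  have h0 := nonneg_of_hasDerivAt_nonneg (f := fun x => x * (Real.sinh x * Real.cosh x) + x ^ 2
    - 2 * Real.sinh x ^ 2) (f' := fun x => x * (Real.cosh x ^ 2 + Real.sinh x ^ 2) + 2 * x
      - 3 * (Real.sinh x * Real.cosh x)) (fun x => by
      have hc := Real.hasDerivAt_cosh x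
      have hs := Real.hasDerivAt_sinh x
      refine ((((hasDerivAt_id' x).mul (hs.mul hc)).add
        ((hasDerivAt_id' x).pow 2)).sub ((hs.pow 2).const_mul 2)).congr_deriv ?_
      simp only [Pi.mul_apply]
      push_cast
      ring) (by simp) h1 hr
  linarith

theorem antitoneOn_gFun : AntitoneOn gFun (Set.Ioi 0) := by
  have hd : ∀ r : ℝ, 0 < r → HasDerivAt gFun
      ((2 * Real.sinh r ^ 2 - (r * (Real.sinh r * Real.cosh r) + r ^ 2)) /
        (r ^ 3 * Real.sinh r ^ 2)) r := fun r hr => by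
    have hs0 := Real.sinh_pos_iff.2 hr
    have hc := Real.hasDerivAt_cosh r
    have hs := Real.hasDerivAt_sinh r
    refine (((((hasDerivAt_id' r).mul (hc.div hs hs0.ne')).sub_const 1).div
      ((hasDerivAt_id' r).pow 2) (pow_pos hr 2).ne')).congr_deriv ?_
    simp only [Pi.div_apply, Pi.mul_apply, Pi.pow_apply]
    have := Real.cosh_sq r
    push_cast
    field_simp
    linear_combination (-r ^ 2) * this
  refine antitoneOn_of_deriv_nonpos (convex_Ioi 0)
    (fun z hz => (hd z hz).continuousAt.continuousWithinAt)
    (fun z hz => (hd z (by simpa using hz)).differentiableAt.differentiableWithinAt) fun z hz => ?_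
  rw [interior_Ioi] at hz
  have hz' : 0 < z := hz
  rw [(hd z hz).deriv]
  have hs0 := Real.sinh_pos_iff.2 hz'
  exact div_nonpos_of_nonpos_of_nonneg (by linarith [two_mul_sinh_sq_le hz'.le]) (by positivity)

theorem gFun_nonneg {r : ℝ} (hr : 0 < r) : 0 ≤ gFun r := by
  have hs0 := Real.sinh_pos_iff.2 hr
  have h := sinh_le_mul_cosh hr.le
  refine div_nonneg ?_ (by positivity)
  rw [sub_nonneg, ← mul_div_assoc, le_div_iff₀ hs0]
  linarith

/-- The radial component `b coth r - a / r` of `-∇ log (r ^ a / sinh ^ b r)`. -/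
noncomputable def radialField (b a r : ℝ) : ℝ := b * (Real.cosh r / Real.sinh r) - a / r

/-- Follows from `coth r ≥ 1/r`. The sign matters when the field is truncated: the derivative of the
increasing cutoff then contributes a nonnegative term. -/
theorem radialField_nonneg {b a r : ℝ} (ha : 0 ≤ a) (hab : a ≤ b) (hr : 0 < r) :
    0 ≤ radialField b a r := by
  have hs0 := Real.sinh_pos_iff.2 hr
  have hc := Real.cosh_pos r
  have h : 1 / r ≤ Real.cosh r / Real.sinh r := by
    rw [div_le_div_iff₀ hr hs0]; linarith [sinh_le_mul_cosh hr.le]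
  have h1 : a * (1 / r) ≤ a * (Real.cosh r / Real.sinh r) := mul_le_mul_of_nonneg_left h ha
  have h2 : a * (Real.cosh r / Real.sinh r) ≤ b * (Real.cosh r / Real.sinh r) :=
    mul_le_mul_of_nonneg_right hab (by positivity)
  have h3 : a / r = a * (1 / r) := by ring
  unfold radialField
  linarith

theorem hasDerivAt_radialField {b a r : ℝ} (hr : 0 < r) :
    HasDerivAt (radialField b a) (a / r ^ 2 - b / Real.sinh r ^ 2) r := by
  have hs0 := Real.sinh_pos_iff.2 hr
  refine ((((Real.hasDerivAt_cosh r).div (Real.hasDerivAt_sinh r) hs0.ne').const_mul b).sub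
    ((hasDerivAt_const r a).div (hasDerivAt_id' r) hr.ne')).congr_deriv ?_
  have := Real.cosh_sq r
  field_simp
  linear_combination (-b * r ^ 2) * this

end Hyperbolic

/-! ### The sine-squared cutoff. -/

section Bump

/-- Freezing the argument at a critical point of `F` keeps the function continuously differentiable.
-/
theorem hasDerivAt_comp_max {F F' : ℝ → ℝ} (hF : ∀ t, HasDerivAt F (F' t) t) (hF' : Continuous F')
    {a : ℝ} (ha : F' a = 0) (t : ℝ) :
    HasDerivAt (fun t => F (max a t)) (F' (max a t)) t := by
  have hc : Continuous F := continuous_iff_continuousAt.2 fun t => (hF t).continuousAt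
  refine hasDerivAt_of_hasDerivAt_of_ne' (f := fun t => F (max a t))
    (g := fun t => F' (max a t)) (x := a) (fun y hy => ?_) (by fun_prop) (by fun_prop) t
  rcases lt_or_gt_of_ne hy with h | h
  · simp only [max_eq_left h.le, ha]
    refine (hasDerivAt_const y (F a)).congr_of_eventuallyEq ?_
    filter_upwards [eventually_lt_nhds h] with z hz using by rw [max_eq_left hz.le]
  · simp only [max_eq_right h.le]
    refine (hF y).congr_of_eventuallyEq ?_
    filter_upwards [eventually_gt_nhds h] with z hz using by rw [max_eq_right hz.le]

theorem hasDerivAt_comp_min {F F' : ℝ → ℝ} (hF : ∀ t, HasDerivAt F (F' t) t) (hF' : Continuous F')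
    {a : ℝ} (ha : F' a = 0) (t : ℝ) :
    HasDerivAt (fun t => F (min t a)) (F' (min t a)) t := by
  have hc : Continuous F := continuous_iff_continuousAt.2 fun t => (hF t).continuousAt
  refine hasDerivAt_of_hasDerivAt_of_ne' (f := fun t => F (min t a))
    (g := fun t => F' (min t a)) (x := a) (fun y hy => ?_) (by fun_prop) (by fun_prop) t
  rcases lt_or_gt_of_ne hy with h | h
  · simp only [min_eq_left h.le]
    refine (hF y).congr_of_eventuallyEq ?_
    filter_upwards [eventually_lt_nhds h] with z hz using by rw [min_eq_left hz.le]
  · simp only [min_eq_right h.le, ha]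
    refine (hasDerivAt_const y (F a)).congr_of_eventuallyEq ?_
    filter_upwards [eventually_gt_nhds h] with z hz using by rw [min_eq_right hz.le]

/-- The `C¹` cutoff equal to `1` on `t ≤ 1/2`, to `sin² (π t)` on `[1/2, 1]` and to `0` on
`1 ≤ t`. -/
noncomputable def sinCutoff (t : ℝ) : ℝ := Real.sin (Real.pi * max (1 / 2) (min t 1)) ^ 2

/-- The derivative of `sinCutoff`. -/
noncomputable def sinCutoffDeriv (t : ℝ) : ℝ :=
  2 * Real.pi * Real.sin (Real.pi * max (1 / 2) (min t 1))
    * Real.cos (Real.pi * max (1 / 2) (min t 1))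

theorem hasDerivAt_sinCutoff (t : ℝ) : HasDerivAt sinCutoff (sinCutoffDeriv t) t := by
  have h0 : ∀ t, HasDerivAt (fun t => Real.sin (Real.pi * t) ^ 2)
      (2 * Real.pi * Real.sin (Real.pi * t) * Real.cos (Real.pi * t)) t := fun t =>
    ((((hasDerivAt_id' t).const_mul Real.pi).sin).pow 2).congr_deriv (by push_cast; ring)
  have h1 := hasDerivAt_comp_max h0 (by fun_prop) (a := 1 / 2)
    (by rw [mul_one_div, Real.cos_pi_div_two, mul_zero])
  exact hasDerivAt_comp_min h1 (by fun_prop) (a := 1)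
    (by rw [max_eq_right (by norm_num)]; simp) t

theorem continuous_sinCutoffDeriv : Continuous sinCutoffDeriv := by
  unfold sinCutoffDeriv; fun_prop

theorem contDiff_sinCutoff : ContDiff ℝ 1 sinCutoff := by
  rw [contDiff_one_iff_deriv]
  refine ⟨fun t => (hasDerivAt_sinCutoff t).differentiableAt, ?_⟩
  rw [show deriv sinCutoff = sinCutoffDeriv from funext fun t => (hasDerivAt_sinCutoff t).deriv]
  exact continuous_sinCutoffDeriv

theorem sinCutoff_of_le {t : ℝ} (ht : t ≤ 1 / 2) : sinCutoff t = 1 := by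
  rw [sinCutoff, max_eq_left ((min_le_left _ _).trans ht), mul_one_div, Real.sin_pi_div_two,
    one_pow]

theorem sinCutoff_of_ge {t : ℝ} (ht : 1 ≤ t) : sinCutoff t = 0 := by
  rw [sinCutoff, min_eq_right ht, max_eq_right (by norm_num)]; simp

theorem sinCutoffDeriv_of_ge {t : ℝ} (ht : 1 ≤ t) : sinCutoffDeriv t = 0 := by
  rw [sinCutoffDeriv, min_eq_right ht, max_eq_right (by norm_num)]; simp

theorem sinCutoff_nonneg (t : ℝ) : 0 ≤ sinCutoff t := sq_nonneg _

theorem sinCutoff_le_one (t : ℝ) : sinCutoff t ≤ 1 := Real.sin_sq_le_one _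

/-- The reason for choosing `sin²`: `p'² / (4p(1 - p))` is the constant `π²`, which becomes the
localization error. -/
theorem sinCutoffDeriv_sq (t : ℝ) :
    sinCutoffDeriv t ^ 2 = 4 * Real.pi ^ 2 * (sinCutoff t * (1 - sinCutoff t)) := by
  unfold sinCutoffDeriv sinCutoff
  rw [mul_pow, Real.cos_sq']
  ring

theorem sinCutoffDeriv_nonpos (t : ℝ) : sinCutoffDeriv t ≤ 0 := by
  have hp := Real.pi_pos
  have h1 : (1 / 2 : ℝ) ≤ max (1 / 2) (min t 1) := le_max_left _ _
  have h2 : max (1 / 2) (min t 1) ≤ (1 : ℝ) := max_le (by norm_num) (min_le_right _ _)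
  unfold sinCutoffDeriv
  set s := max (1 / 2) (min t 1)
  refine mul_nonpos_of_nonneg_of_nonpos (mul_nonneg (by positivity)
    (Real.sin_nonneg_of_nonneg_of_le_pi (by positivity) (by nlinarith)))
    (Real.cos_nonpos_of_pi_div_two_le_of_le (by nlinarith) (by nlinarith))

/-- Quadratic vanishing that compensates the `1/r²` singularity of the potential near a pole. -/
theorem one_sub_sinCutoff_le (t : ℝ) : 1 - sinCutoff t ≤ 2 * t ^ 2 := by
  rcases le_or_gt t (1 / 2) with h | h
  · rw [sinCutoff_of_le h]; nlinarith [sq_nonneg t]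
  rcases le_or_gt (1 / 2) (t ^ 2) with h' | h'
  · linarith [sinCutoff_nonneg t]
  -- The bound slightly exceeds `1/√2`; only `1/2 < t < 1/√2` remains.
  have ht : t < 0.7072 := by nlinarith
  rw [sinCutoff, min_eq_left (by linarith), max_eq_right h.le, ← Real.cos_sq']
  have hp := Real.pi_pos
  have hp' := Real.pi_lt_d2
  have e : Real.cos (Real.pi * t) = -Real.sin (Real.pi * (t - 1 / 2)) := by
    rw [← Real.cos_add_pi_div_two]; congr 1; ring
  have h0 : 0 ≤ Real.pi * (t - 1 / 2) := mul_nonneg hp.le (by linarith)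
  have h1 : Real.sin (Real.pi * (t - 1 / 2)) ≤ Real.pi * (t - 1 / 2) := Real.sin_le h0
  have h2 : 0 ≤ Real.sin (Real.pi * (t - 1 / 2)) :=
    Real.sin_nonneg_of_nonneg_of_le_pi h0 (by nlinarith)
  have h3 : Real.pi * (t - 1 / 2) ≤ 3.15 * (t - 1 / 2) := by nlinarith
  have h4 : Real.sin (Real.pi * (t - 1 / 2)) ^ 2 ≤ (3.15 * (t - 1 / 2)) ^ 2 :=
    pow_le_pow_left₀ h2 (h1.trans h3) 2
  rw [e, neg_sq]
  nlinarith

end Bump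

/-! ### Smoothness of radial functions across the pole. -/

section CompArcosh

theorem eventually_arcosh_lt {ε : ℝ} (hε : 0 < ε) : ∀ᶠ s in nhds (1 : ℝ), Real.arcosh s < ε := by
  have h1 : (1 : ℝ) < Real.cosh ε := Real.one_lt_cosh.2 hε.ne'
  filter_upwards [eventually_lt_nhds h1, eventually_gt_nhds one_pos] with s hs hs0
  rwa [← Real.arcosh_cosh hε.le, Real.arcosh_lt_arcosh hs0 (Real.cosh_pos _)]

variable {F F' : ℝ → ℝ} {ε σ : ℝ}

/-- `arcosh` is not differentiable at `1`, so `F` is required to be constant near the pole. The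
hypothesis also covers negative arguments, because `Real.arcosh` is negative just below `1`. At `σ =
1` the stated derivative is a division by zero, whose value `0` is the correct one. -/
theorem hasDerivAt_comp_arcosh (hε : 0 < ε) (hc : ∀ r < ε, F r = F 0)
    (hF : ∀ r, 0 < r → HasDerivAt F (F' r) r) (hσ : 1 ≤ σ) :
    HasDerivAt (fun s => F (Real.arcosh s)) (F' (Real.arcosh σ) / Real.sinh (Real.arcosh σ)) σ := by
  rcases hσ.eq_or_lt with rfl | h
  · simp only [Real.arcosh_zero, Real.sinh_zero, div_zero]
    refine (hasDerivAt_const (1 : ℝ) (F 0)).congr_of_eventuallyEq ?_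
    filter_upwards [eventually_arcosh_lt hε] with s hs using hc _ hs
  · rw [Real.sinh_arcosh hσ, div_eq_mul_inv]
    exact (hF _ (Real.arcosh_pos h)).comp σ (Real.hasDerivAt_arcosh h)

theorem contDiffAt_comp_arcosh (hε : 0 < ε) (hc : ∀ r < ε, F r = F 0)
    (hF : ∀ r, 0 < r → ContDiffAt ℝ 1 F r) (hσ : 1 ≤ σ) :
    ContDiffAt ℝ 1 (fun s => F (Real.arcosh s)) σ := by
  rcases hσ.eq_or_lt with rfl | h
  · refine (contDiffAt_const (c := F 0)).congr_of_eventuallyEq ?_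
    filter_upwards [eventually_arcosh_lt hε] with s hs using hc _ hs
  · exact (hF _ (Real.arcosh_pos h)).comp σ (Real.contDiffAt_arcosh h)

end CompArcosh

/-! ### Radial functions and radial fluxes on the ball. -/

section Smoothness

variable {N : ℕ} {x y : EuclideanSpace ℝ (Fin N)}

theorem contDiffAt_confFactor (hx : x ∈ hypBall N) : ContDiffAt ℝ 1 confFactor x := by
  unfold confFactor
  exact contDiffAt_const.div (contDiffAt_const.sub (contDiff_norm_sq ℝ).contDiffAt)
    (one_sub_norm_sq_pos hx).ne'

theorem contDiffAt_coshDist (hy : y ∈ hypBall N) (hx : x ∈ hypBall N) :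
    ContDiffAt ℝ 1 (coshDist y) x := by
  unfold coshDist
  refine contDiffAt_const.add ((contDiffAt_const.mul ?_).div
    ((contDiffAt_const.sub (contDiff_norm_sq ℝ).contDiffAt).mul contDiffAt_const)
    (mul_pos (one_sub_norm_sq_pos hx) (one_sub_norm_sq_pos hy)).ne')
  exact (contDiffAt_id.sub contDiffAt_const).norm_sq ℝ

theorem contDiffAt_gradCoshDist (hy : y ∈ hypBall N) (hx : x ∈ hypBall N) :
    ContDiffAt ℝ 1 (gradCoshDist y) x := by
  have h : ContDiffAt ℝ 1 (fun z : EuclideanSpace ℝ (Fin N) => 1 - ‖z‖ ^ 2) x :=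
    contDiffAt_const.sub (contDiff_norm_sq ℝ).contDiffAt
  unfold gradCoshDist
  refine (contDiffAt_const.div (contDiffAt_const.mul (h.pow 2))
    (mul_pos (one_sub_norm_sq_pos hy) (pow_pos (one_sub_norm_sq_pos hx) 2)).ne').smul
    ((h.smul (contDiffAt_id.sub contDiffAt_const)).add
      (((contDiffAt_id.sub contDiffAt_const).norm_sq ℝ).smul contDiffAt_id))

/-- The radial field `F(r) ∇ cosh r`, weighted by the power of the conformal factor which turns
the hyperbolic divergence into the Euclidean one. -/
noncomputable def radialFlux (F : ℝ → ℝ) (y x : EuclideanSpace ℝ (Fin N)) :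
    EuclideanSpace ℝ (Fin N) :=
  F (hypDist x y) • (confFactor x ^ (N - 2) • gradCoshDist y x)

variable {F F' : ℝ → ℝ} {ε : ℝ}

theorem contDiffAt_comp_hypDist (hε : 0 < ε) (hc : ∀ r < ε, F r = F 0)
    (hF : ∀ r, 0 < r → ContDiffAt ℝ 1 F r) (hy : y ∈ hypBall N) (hx : x ∈ hypBall N) :
    ContDiffAt ℝ 1 (fun z => F (hypDist z y)) x :=
  (contDiffAt_comp_arcosh hε hc hF (one_le_coshDist hy hx)).comp x (contDiffAt_coshDist hy hx)

theorem hasGradientAt_comp_hypDist (hε : 0 < ε) (hc : ∀ r < ε, F r = F 0)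
    (hF : ∀ r, 0 < r → HasDerivAt F (F' r) r) (hy : y ∈ hypBall N) (hx : x ∈ hypBall N) :
    HasGradientAt (fun z => F (hypDist z y))
      ((F' (hypDist x y) / Real.sinh (hypDist x y)) • gradCoshDist y x) x :=
  HasGradientAt.comp_hasDerivAt (h := coshDist y) (f := fun s => F (Real.arcosh s))
    (hasDerivAt_comp_arcosh hε hc hF (one_le_coshDist hy hx))
    (hasGradientAt_coshDist hy hx)

theorem norm_gradCoshDist_sq' (hy : y ∈ hypBall N) (hx : x ∈ hypBall N) :
    ‖gradCoshDist y x‖ ^ 2 = confFactor x ^ 2 * Real.sinh (hypDist x y) ^ 2 := by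
  rw [norm_gradCoshDist_sq hy hx, ← cosh_hypDist hx hy, Real.cosh_sq, add_sub_cancel_right]

/-- Equality holds off the pole; at the pole the left side is `0` by division by zero, hence only an
inequality. -/
theorem norm_gradient_comp_hypDist_sq_le (hy : y ∈ hypBall N) (hx : x ∈ hypBall N) (c : ℝ) :
    ‖(c / Real.sinh (hypDist x y)) • gradCoshDist y x‖ ^ 2 ≤ confFactor x ^ 2 * c ^ 2 := by
  rw [norm_smul, mul_pow, norm_gradCoshDist_sq' hy hx, Real.norm_eq_abs, sq_abs, div_pow]
  rcases eq_or_ne (Real.sinh (hypDist x y)) 0 with h | h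
  · rw [h]; simp; positivity
  · exact le_of_eq (by field_simp)

theorem contDiffAt_weight_gradCoshDist (hy : y ∈ hypBall N) (hx : x ∈ hypBall N) :
    ContDiffAt ℝ 1 (fun z => confFactor z ^ (N - 2) • gradCoshDist y z) x :=
  ((contDiffAt_confFactor hx).pow _).smul (contDiffAt_gradCoshDist hy hx)

theorem contDiffAt_radialFlux (hε : 0 < ε) (hc : ∀ r < ε, F r = F 0)
    (hF : ∀ r, 0 < r → ContDiffAt ℝ 1 F r) (hy : y ∈ hypBall N) (hx : x ∈ hypBall N) :
    ContDiffAt ℝ 1 (radialFlux F y) x :=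
  (contDiffAt_comp_hypDist hε hc hF hy hx).smul (contDiffAt_weight_gradCoshDist hy hx)

theorem confFactor_pow (hN : 2 ≤ N) (x : EuclideanSpace ℝ (Fin N)) :
    confFactor x ^ N = confFactor x ^ (N - 2) * confFactor x ^ 2 := by
  rw [← pow_add, Nat.sub_add_cancel hN]

theorem euclDiv_radialFlux (hN : 2 ≤ N) (hε : 0 < ε) (hc : ∀ r < ε, F r = F 0)
    (hF : ∀ r, 0 < r → HasDerivAt F (F' r) r) (hy : y ∈ hypBall N) (hx : x ∈ hypBall N) :
    euclDiv (radialFlux F y) x = confFactor x ^ N * (F' (hypDist x y) * Real.sinh (hypDist x y)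
      + N * F (hypDist x y) * Real.cosh (hypDist x y)) := by
  unfold radialFlux
  rw [euclDiv_smul (hasGradientAt_comp_hypDist hε hc hF hy hx)
    ((contDiffAt_weight_gradCoshDist hy hx).differentiableAt one_ne_zero),
    euclDiv_weight_gradCoshDist hN hy hx, inner_smul_left, inner_smul_right,
    real_inner_self_eq_norm_sq, norm_gradCoshDist_sq' hy hx, cosh_hypDist hx hy, conj_trivial,
    confFactor_pow hN]
  rcases eq_or_ne (Real.sinh (hypDist x y)) 0 with h | h
  · rw [h]; simp; ring
  · field_simp

theorem norm_radialFlux_sq (hN : 2 ≤ N) (hy : y ∈ hypBall N) (hx : x ∈ hypBall N) :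
    (confFactor x ^ (N - 2))⁻¹ * ‖radialFlux F y x‖ ^ 2
      = confFactor x ^ N * (F (hypDist x y) ^ 2 * Real.sinh (hypDist x y) ^ 2) := by
  have h := confFactor_pos hx
  unfold radialFlux
  rw [norm_smul, norm_smul, mul_pow, mul_pow, norm_gradCoshDist_sq' hy hx, Real.norm_eq_abs,
    sq_abs, Real.norm_eq_abs, sq_abs, confFactor_pow hN]
  field_simp

end Smoothness

/-! ### The unipolar ground state and its Riccati identity. -/

section Profile

/-- The radial profile of the potential `potV`. -/
noncomputable def radialPot (N : ℕ) (lam r : ℝ) : ℝ :=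
  constH N lam * (1 / r ^ 2) + constC N lam * (1 / Real.sinh r ^ 2) + constD N lam * gFun r

/-- The logarithmic derivative field of the unipolar ground state
`r ^ a / sinh ^ b r`, `a = (1 + γ) / 2`, `b = (N - 1 + γ) / 2`. -/
noncomputable def groundField (N : ℕ) (lam r : ℝ) : ℝ :=
  radialField (((N : ℝ) - 1 + gammaN N lam) / 2) ((1 + gammaN N lam) / 2) r

/-- The cutoff which vanishes on `r ≤ ε` and equals `1` on `2 ε ≤ r`. -/
noncomputable def poleCutoff (ε r : ℝ) : ℝ := 1 - sinCutoff (r / (2 * ε))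

theorem hasDerivAt_poleCutoff (ε r : ℝ) :
    HasDerivAt (poleCutoff ε) (-(sinCutoffDeriv (r / (2 * ε)) / (2 * ε))) r := by
  have h := ((hasDerivAt_sinCutoff (r / (2 * ε))).comp r ((hasDerivAt_id' r).div_const (2 * ε)))
  exact (h.const_sub 1).congr_deriv (by ring)

theorem contDiff_poleCutoff (ε : ℝ) : ContDiff ℝ 1 (poleCutoff ε) :=
  contDiff_const.sub (contDiff_sinCutoff.comp (contDiff_id.div_const _))

theorem poleCutoff_of_le {ε r : ℝ} (hε : 0 < ε) (hr : r ≤ ε) : poleCutoff ε r = 0 := by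
  rw [poleCutoff, sinCutoff_of_le, sub_self]
  rw [div_le_div_iff₀ (by positivity) two_pos]; linarith

theorem poleCutoff_of_ge {ε r : ℝ} (hε : 0 < ε) (hr : 2 * ε ≤ r) : poleCutoff ε r = 1 := by
  rw [poleCutoff, sinCutoff_of_ge, sub_zero]
  rwa [one_le_div (by positivity)]

theorem poleCutoff_nonneg (ε r : ℝ) : 0 ≤ poleCutoff ε r := sub_nonneg.2 (sinCutoff_le_one _)

theorem poleCutoff_le_one (ε r : ℝ) : poleCutoff ε r ≤ 1 := sub_le_self _ (sinCutoff_nonneg _)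

/-- The truncated ground state field, divided by `sinh`. -/
noncomputable def truncProfile (N : ℕ) (lam ε r : ℝ) : ℝ :=
  poleCutoff ε r * groundField N lam r / Real.sinh r

/-- The derivative of `truncProfile`. -/
noncomputable def truncProfileDeriv (N : ℕ) (lam ε r : ℝ) : ℝ :=
  ((-(sinCutoffDeriv (r / (2 * ε)) / (2 * ε)) * groundField N lam r + poleCutoff ε r *
    ((1 + gammaN N lam) / 2 / r ^ 2 - ((N : ℝ) - 1 + gammaN N lam) / 2 / Real.sinh r ^ 2))
      * Real.sinh r - poleCutoff ε r * groundField N lam r * Real.cosh r) / Real.sinh r ^ 2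

variable {N : ℕ} {lam ε r : ℝ}

theorem truncProfile_of_lt (hε : 0 < ε) (hr : r < ε) : truncProfile N lam ε r = 0 := by
  rw [truncProfile, poleCutoff_of_le hε hr.le, zero_mul, zero_div]

theorem hasDerivAt_truncProfile (hr : 0 < r) :
    HasDerivAt (truncProfile N lam ε) (truncProfileDeriv N lam ε r) r :=
  ((hasDerivAt_poleCutoff ε r).mul (hasDerivAt_radialField hr)).div (Real.hasDerivAt_sinh r)
    (Real.sinh_pos_iff.2 hr).ne'

theorem contDiffAt_truncProfile (hr : 0 < r) : ContDiffAt ℝ 1 (truncProfile N lam ε) r := by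
  have h := (Real.sinh_pos_iff.2 hr).ne'
  have hs : ContDiffAt ℝ 1 Real.sinh r := Real.contDiff_sinh.contDiffAt
  have hc : ContDiffAt ℝ 1 Real.cosh r := Real.contDiff_cosh.contDiffAt
  unfold truncProfile groundField radialField
  exact ((contDiff_poleCutoff ε).contDiffAt.mul ((contDiffAt_const.mul (hc.div hs h)).sub
    (contDiffAt_const.div contDiffAt_id hr.ne'))).div hs h

theorem gammaN_nonneg : 0 ≤ gammaN N lam := Real.sqrt_nonneg _

theorem gammaN_sq (h : lam ≤ (((N : ℝ) - 1) / 2) ^ 2) :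
    gammaN N lam ^ 2 = ((N : ℝ) - 1) ^ 2 - 4 * lam :=
  Real.sq_sqrt (by linarith)

/-- Expanding in `coth²`, `coth / r` and `1/r²`, with `a = (1 + γ)/2` and `b = (N - 1 + γ)/2`: `b(N
- 1 - b) = λ`, `λ - b = C`, `aγ = D`, and `a - a² + D = H` once `coth r / r` is written as `g +
1/r²`. -/
theorem groundField_riccati (h : lam ≤ (((N : ℝ) - 1) / 2) ^ 2) (hr : 0 < r) :
    ((1 + gammaN N lam) / 2 / r ^ 2 - ((N : ℝ) - 1 + gammaN N lam) / 2 / Real.sinh r ^ 2)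
      + ((N : ℝ) - 1) * (Real.cosh r / Real.sinh r) * groundField N lam r
      - groundField N lam r ^ 2 = lam + radialPot N lam r := by
  have hs := Real.sinh_pos_iff.2 hr
  have hg := gammaN_sq h
  have hc := Real.cosh_sq r
  have hl : lam = (((N : ℝ) - 1) ^ 2 - gammaN N lam ^ 2) / 4 := by linarith
  unfold radialPot groundField radialField constH constC constD gFun
  set g := gammaN N lam
  rw [hl]
  field_simp
  linear_combination 4 * r ^ 2 * ((N : ℝ) - 1 + g) * ((N : ℝ) - 1 - g) * hc

/-- With cutoff `χ` and field `f ≥ 0`, truncation adds `χ' f ≥ 0` and replaces `χ f²` by the smaller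
`χ² f²`, so the identity survives as an inequality. -/
theorem truncProfile_riccati (hN : 3 ≤ N) (h : lam ≤ (((N : ℝ) - 1) / 2) ^ 2) (hε : 0 < ε)
    (hr : 0 ≤ r) :
    poleCutoff ε r * (lam + radialPot N lam r) ≤
      truncProfileDeriv N lam ε r * Real.sinh r + N * truncProfile N lam ε r * Real.cosh r
        - truncProfile N lam ε r ^ 2 * Real.sinh r ^ 2 := by
  rcases hr.eq_or_lt with rfl | hr
  · rw [poleCutoff_of_le hε hε.le, truncProfile_of_lt hε hε]; simp
  have hs := Real.sinh_pos_iff.2 hr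
  have hN' : (3 : ℝ) ≤ N := by exact_mod_cast hN
  have hg : 0 ≤ gammaN N lam := gammaN_nonneg
  have hf : 0 ≤ groundField N lam r :=
    radialField_nonneg (by positivity) (by linarith) hr
  have hR := groundField_riccati h hr
  have h0 := poleCutoff_nonneg ε r
  have h1 := poleCutoff_le_one ε r
  have hd : 0 ≤ -(sinCutoffDeriv (r / (2 * ε)) / (2 * ε)) :=
    neg_nonneg.2 (div_nonpos_of_nonpos_of_nonneg (sinCutoffDeriv_nonpos _) (by positivity))
  have e : truncProfileDeriv N lam ε r * Real.sinh r + N * truncProfile N lam ε r * Real.cosh r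
        - truncProfile N lam ε r ^ 2 * Real.sinh r ^ 2
      = -(sinCutoffDeriv (r / (2 * ε)) / (2 * ε)) * groundField N lam r
        + poleCutoff ε r * (((1 + gammaN N lam) / 2 / r ^ 2
          - ((N : ℝ) - 1 + gammaN N lam) / 2 / Real.sinh r ^ 2)
          + ((N : ℝ) - 1) * (Real.cosh r / Real.sinh r) * groundField N lam r)
        - poleCutoff ε r ^ 2 * groundField N lam r ^ 2 := by
    unfold truncProfileDeriv truncProfile
    set d := -(sinCutoffDeriv (r / (2 * ε)) / (2 * ε))
    set f := groundField N lam r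
    set A := (1 + gammaN N lam) / 2 / r ^ 2 - ((N : ℝ) - 1 + gammaN N lam) / 2 / Real.sinh r ^ 2
    field_simp
    ring
  rw [e, ← hR]
  nlinarith [mul_nonneg hd hf, mul_nonneg (mul_nonneg h0 (sub_nonneg.2 h1))
    (sq_nonneg (groundField N lam r))]

end Profile

/-! ### Gluing the unipolar fluxes. -/

section Localization

/-- The squared norm of a convex combination falls short of the combination of squared norms by `p(1
- p)‖B - A‖²`. By Cauchy-Schwarz and AM-GM this gain absorbs the gradient term, leaving only the
cost `κ`. -/
theorem ims_localization_le {E : Type*} [NormedAddCommGroup E] [InnerProductSpace ℝ E]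
    {A B g : E} {p w ρ κ D₁ D₂ R₁ R₂ : ℝ} (hw : 0 < w) (hκ : 0 ≤ κ) (hp0 : 0 ≤ p) (hp1 : p ≤ 1)
    (hg : ‖g‖ ^ 2 ≤ ρ ^ 2 * (4 * κ * (p * (1 - p))))
    (h₁ : R₁ ≤ D₁ - w⁻¹ * ‖A‖ ^ 2) (h₂ : R₂ ≤ D₂ - w⁻¹ * ‖B‖ ^ 2) :
    (1 - p) * R₁ + p * R₂ - w * ρ ^ 2 * κ ≤
      D₁ + (inner ℝ g (B - A) + p * (D₂ - D₁)) - w⁻¹ * ‖A + p • (B - A)‖ ^ 2 := by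
  have hn : ‖A + p • (B - A)‖ ^ 2
      = (1 - p) * ‖A‖ ^ 2 + p * ‖B‖ ^ 2 - p * (1 - p) * ‖B - A‖ ^ 2 := by
    rw [norm_add_sq_real, norm_smul, mul_pow, Real.norm_eq_abs, sq_abs, inner_smul_right,
      inner_sub_right, real_inner_self_eq_norm_sq, norm_sub_sq_real, real_inner_comm]
    ring
  have hi : inner ℝ g (B - A) ^ 2 ≤ ‖g‖ ^ 2 * ‖B - A‖ ^ 2 := by
    rw [← mul_pow]
    refine sq_le_sq.2 ?_
    rw [abs_of_nonneg (a := ‖g‖ * ‖B - A‖) (by positivity)]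
    exact abs_real_inner_le_norm _ _
  have hq : 0 ≤ p * (1 - p) := mul_nonneg hp0 (sub_nonneg.2 hp1)
  have hwi : 0 < w⁻¹ := inv_pos.2 hw
  have hz : -inner ℝ g (B - A) ≤ w⁻¹ * (p * (1 - p) * ‖B - A‖ ^ 2) + w * ρ ^ 2 * κ := by
    refine neg_le.1 (abs_le.1 (abs_le_of_sq_le_sq ?_ (by positivity))).1
    calc inner ℝ g (B - A) ^ 2 ≤ ‖g‖ ^ 2 * ‖B - A‖ ^ 2 := hi
      _ ≤ ρ ^ 2 * (4 * κ * (p * (1 - p))) * ‖B - A‖ ^ 2 :=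
        mul_le_mul_of_nonneg_right hg (sq_nonneg _)
      _ = 4 * (w⁻¹ * (p * (1 - p) * ‖B - A‖ ^ 2)) * (w * ρ ^ 2 * κ) := by field_simp
      _ ≤ _ := by
        nlinarith [sq_nonneg (w⁻¹ * (p * (1 - p) * ‖B - A‖ ^ 2) - w * ρ ^ 2 * κ)]
  rw [hn]
  have m₁ := mul_le_mul_of_nonneg_left h₁ (sub_nonneg.2 hp1)
  have m₂ := mul_le_mul_of_nonneg_left h₂ hp0
  linarith

variable {N M : ℕ} {x : EuclideanSpace ℝ (Fin N)} {y : Fin M → EuclideanSpace ℝ (Fin N)}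
  {lam d ε : ℝ}

/-- The partition function around the pole `y`. -/
noncomputable def polePart (d : ℝ) (y x : EuclideanSpace ℝ (Fin N)) : ℝ :=
  sinCutoff (hypDist x y / d)

/-- The truncated unipolar flux around the pole `y`. -/
noncomputable def poleFlux (lam ε : ℝ) (y x : EuclideanSpace ℝ (Fin N)) :
    EuclideanSpace ℝ (Fin N) :=
  radialFlux (truncProfile N lam ε) y x

/-- The truncated unipolar lower bound. -/
noncomputable def polePot (lam ε : ℝ) (y x : EuclideanSpace ℝ (Fin N)) : ℝ :=
  poleCutoff ε (hypDist x y) * (lam + potV N lam y x)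

/-- The multipolar flux: the truncated unipolar fluxes glued by the partition functions, with the
pole `y k₁` used away from all poles. -/
noncomputable def multiFlux (lam d ε : ℝ) (y : Fin M → EuclideanSpace ℝ (Fin N)) (k₁ : Fin M)
    (x : EuclideanSpace ℝ (Fin N)) : EuclideanSpace ℝ (Fin N) :=
  poleFlux lam ε (y k₁) x
    + ∑ k, polePart d (y k) x • (poleFlux lam ε (y k) x - poleFlux lam ε (y k₁) x)

/-- The lower bound produced by `multiFlux`. -/
noncomputable def multiLower (lam d ε : ℝ) (y : Fin M → EuclideanSpace ℝ (Fin N)) (k₁ : Fin M)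
    (x : EuclideanSpace ℝ (Fin N)) : ℝ :=
  polePot lam ε (y k₁) x
    + ∑ k, polePart d (y k) x * (polePot lam ε (y k) x - polePot lam ε (y k₁) x)

theorem truncProfile_eq_of_lt (hε : 0 < ε) (r : ℝ) (hr : r < ε) :
    truncProfile N lam ε r = truncProfile N lam ε 0 := by
  rw [truncProfile_of_lt hε hr, truncProfile_of_lt hε hε]

theorem contDiffAt_poleFlux {y : EuclideanSpace ℝ (Fin N)} (hε : 0 < ε) (hy : y ∈ hypBall N)
    (hx : x ∈ hypBall N) : ContDiffAt ℝ 1 (poleFlux lam ε y) x :=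
  contDiffAt_radialFlux hε (truncProfile_eq_of_lt hε) (fun _ => contDiffAt_truncProfile) hy hx

theorem sinCutoff_div_eq_of_lt (hd : 0 < d) (r : ℝ) (hr : r < d / 2) :
    sinCutoff (r / d) = sinCutoff (0 / d) := by
  rw [sinCutoff_of_le, sinCutoff_of_le (by simp)]
  rw [div_le_div_iff₀ hd two_pos]; linarith

theorem contDiffAt_polePart {y : EuclideanSpace ℝ (Fin N)} (hd : 0 < d) (hy : y ∈ hypBall N)
    (hx : x ∈ hypBall N) : ContDiffAt ℝ 1 (polePart d y) x :=
  contDiffAt_comp_hypDist (F := fun r => sinCutoff (r / d)) (half_pos hd)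
    (sinCutoff_div_eq_of_lt hd)
    (fun _ _ => (contDiff_sinCutoff.comp (contDiff_id.div_const d)).contDiffAt) hy hx

/-- The Euclidean gradient of `polePart`. -/
noncomputable def gradPolePart (d : ℝ) (y x : EuclideanSpace ℝ (Fin N)) :
    EuclideanSpace ℝ (Fin N) :=
  (sinCutoffDeriv (hypDist x y / d) / d / Real.sinh (hypDist x y)) • gradCoshDist y x

theorem hasGradientAt_polePart {y : EuclideanSpace ℝ (Fin N)} (hd : 0 < d) (hy : y ∈ hypBall N)
    (hx : x ∈ hypBall N) : HasGradientAt (polePart d y) (gradPolePart d y x) x := by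
  refine hasGradientAt_comp_hypDist (F := fun r => sinCutoff (r / d))
    (F' := fun r => sinCutoffDeriv (r / d) / d) (half_pos hd)
    (sinCutoff_div_eq_of_lt hd) (fun r _ => ?_) hy hx
  have h := (hasDerivAt_sinCutoff (r / d)).comp r ((hasDerivAt_id' r).div_const d)
  exact h.congr_deriv (by ring)

theorem norm_gradPolePart_sq_le {y : EuclideanSpace ℝ (Fin N)} (hy : y ∈ hypBall N)
    (hx : x ∈ hypBall N) : ‖gradPolePart d y x‖ ^ 2 ≤ confFactor x ^ 2 *
      (4 * (Real.pi ^ 2 / d ^ 2) * (polePart d y x * (1 - polePart d y x))) := by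
  refine (norm_gradient_comp_hypDist_sq_le hy hx _).trans (le_of_eq ?_)
  rw [div_pow, sinCutoffDeriv_sq, polePart]
  ring

theorem polePart_eq_zero {y : EuclideanSpace ℝ (Fin N)} (hd : 0 < d) (h : d ≤ hypDist x y) :
    polePart d y x = 0 :=
  sinCutoff_of_ge ((one_le_div hd).2 h)

theorem gradPolePart_eq_zero {y : EuclideanSpace ℝ (Fin N)} (hd : 0 < d) (h : d ≤ hypDist x y) :
    gradPolePart d y x = 0 := by
  rw [gradPolePart, sinCutoffDeriv_of_ge ((one_le_div hd).2 h)]; simp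

theorem polePot_le_euclDiv {y : EuclideanSpace ℝ (Fin N)} (hN : 3 ≤ N)
    (hlam : lam ≤ (((N : ℝ) - 1) / 2) ^ 2) (hε : 0 < ε) (hy : y ∈ hypBall N)
    (hx : x ∈ hypBall N) :
    confFactor x ^ N * polePot lam ε y x ≤ euclDiv (poleFlux lam ε y) x
      - (confFactor x ^ (N - 2))⁻¹ * ‖poleFlux lam ε y x‖ ^ 2 := by
  have hN2 : 2 ≤ N := by omega
  have h1 := euclDiv_radialFlux hN2 hε (truncProfile_eq_of_lt hε)
    (fun r => hasDerivAt_truncProfile (N := N) (lam := lam) (ε := ε)) hy hx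
  have h2 := norm_radialFlux_sq (F := truncProfile N lam ε) hN2 hy hx
  rw [show poleFlux lam ε y = radialFlux (truncProfile N lam ε) y from rfl, h1, h2, ← mul_sub]
  exact mul_le_mul_of_nonneg_left (truncProfile_riccati hN hlam hε (hypDist_nonneg hx hy))
    (pow_nonneg (confFactor_pos hx).le _)

theorem contDiffAt_multiFlux (hd : 0 < d) (hε : 0 < ε) (hy : ∀ k, y k ∈ hypBall N) (k₁ : Fin M)
    (hx : x ∈ hypBall N) : ContDiffAt ℝ 1 (multiFlux lam d ε y k₁) x :=
  (contDiffAt_poleFlux hε (hy k₁) hx).add (ContDiffAt.sum fun k _ =>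
    (contDiffAt_polePart hd (hy k) hx).smul
      ((contDiffAt_poleFlux hε (hy k) hx).sub (contDiffAt_poleFlux hε (hy k₁) hx)))

theorem euclDiv_multiFlux (hd : 0 < d) (hε : 0 < ε) (hy : ∀ k, y k ∈ hypBall N) (k₁ : Fin M)
    (hx : x ∈ hypBall N) : euclDiv (multiFlux lam d ε y k₁) x = euclDiv (poleFlux lam ε (y k₁)) x
      + ∑ k, (inner ℝ (gradPolePart d (y k) x)
          (poleFlux lam ε (y k) x - poleFlux lam ε (y k₁) x)
        + polePart d (y k) x * (euclDiv (poleFlux lam ε (y k)) x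
          - euclDiv (poleFlux lam ε (y k₁)) x)) := by
  have hD : ∀ k, DifferentiableAt ℝ (poleFlux lam ε (y k)) x := fun k =>
    (contDiffAt_poleFlux hε (hy k) hx).differentiableAt one_ne_zero
  have hS : ∀ k, DifferentiableAt ℝ
      (fun z => poleFlux lam ε (y k) z - poleFlux lam ε (y k₁) z) x := fun k => (hD k).sub (hD k₁)
  have hT : ∀ k, DifferentiableAt ℝ (fun z => polePart d (y k) z •
      (poleFlux lam ε (y k) z - poleFlux lam ε (y k₁) z)) x := fun k =>
    (hasGradientAt_polePart hd (hy k) hx).differentiableAt.smul (hS k)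
  unfold multiFlux
  rw [euclDiv_add (hD k₁) (DifferentiableAt.fun_sum fun k _ => hT k), euclDiv_sum hT]
  congr 1
  refine Finset.sum_congr rfl fun k _ => ?_
  rw [euclDiv_smul (hasGradientAt_polePart hd (hy k) hx) (hS k), euclDiv_sub (hD k) (hD k₁)]

theorem hypDist_ge_of_lt (hy : ∀ k, y k ∈ hypBall N)
    (hsep : ∀ j k, j ≠ k → 2 * d ≤ hypDist (y j) (y k)) (hx : x ∈ hypBall N) {j k : Fin M}
    (hjk : j ≠ k) (hk : hypDist x (y k) < d) : d ≤ hypDist x (y j) := by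
  have h := hypDist_triangle (hy j) hx (hy k)
  rw [hypDist_comm (y j) x] at h
  linarith [hsep j k hjk]

/-- Since the balls of radius `d` are disjoint, at most one cutoff is active at `x`, so the flux is
a convex combination of just two unipolar fluxes. Outside all balls it is the flux of `k₁`, and the
`π²/d²` term is a free loss. -/
theorem multiLower_le_euclDiv (hN : 3 ≤ N) (hlam : lam ≤ (((N : ℝ) - 1) / 2) ^ 2) (hd : 0 < d)
    (hε : 0 < ε) (hy : ∀ k, y k ∈ hypBall N)
    (hsep : ∀ j k, j ≠ k → 2 * d ≤ hypDist (y j) (y k)) (k₁ : Fin M) (hx : x ∈ hypBall N) :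
    confFactor x ^ N * (multiLower lam d ε y k₁ x - Real.pi ^ 2 / d ^ 2) ≤
      euclDiv (multiFlux lam d ε y k₁) x
        - (confFactor x ^ (N - 2))⁻¹ * ‖multiFlux lam d ε y k₁ x‖ ^ 2 := by
  have hρ := confFactor_pos hx
  have hκ : 0 ≤ Real.pi ^ 2 / d ^ 2 := by positivity
  rw [euclDiv_multiFlux hd hε hy k₁ hx]
  unfold multiFlux multiLower
  have h₁ := polePot_le_euclDiv hN hlam hε (hy k₁) hx
  by_cases hex : ∃ k, hypDist x (y k) < d
  · obtain ⟨k, hk⟩ := hex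
    have hz : ∀ j, j ≠ k → polePart d (y j) x = 0 := fun j hj =>
      polePart_eq_zero hd (hypDist_ge_of_lt hy hsep hx hj hk)
    have hz' : ∀ j, j ≠ k → gradPolePart d (y j) x = 0 := fun j hj =>
      gradPolePart_eq_zero hd (hypDist_ge_of_lt hy hsep hx hj hk)
    rw [Finset.sum_eq_single k (fun j _ hj => by rw [hz j hj, zero_mul]) (by simp),
      Finset.sum_eq_single k (fun j _ hj => by rw [hz j hj, hz' j hj]; simp) (by simp),
      Finset.sum_eq_single k (fun j _ hj => by rw [hz j hj, zero_smul]) (by simp)]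
    refine le_trans (le_of_eq ?_) (ims_localization_le (pow_pos hρ (N - 2)) hκ
      (sinCutoff_nonneg _) (sinCutoff_le_one _) (norm_gradPolePart_sq_le (hy k) hx) h₁
      (polePot_le_euclDiv hN hlam hε (hy k) hx))
    rw [← confFactor_pow (by omega)]
    ring
  · push Not at hex
    rw [Finset.sum_eq_zero fun j _ => by rw [polePart_eq_zero hd (hex j), zero_mul],
      Finset.sum_eq_zero fun j _ => by
        rw [polePart_eq_zero hd (hex j), gradPolePart_eq_zero hd (hex j)]; simp,
      Finset.sum_eq_zero fun j _ => by rw [polePart_eq_zero hd (hex j), zero_smul]]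
    simp only [add_zero]
    nlinarith [mul_nonneg (pow_nonneg hρ.le N) hκ]

end Localization

/-! ### Integration against the hyperbolic volume. -/

section Integration

variable {N : ℕ} {u : EuclideanSpace ℝ (Fin N) → ℝ}

theorem measurableSet_hypBall : MeasurableSet (hypBall N) := measurableSet_ball

theorem measurable_confFactor : Measurable (confFactor (N := N)) := by
  unfold confFactor; fun_prop

theorem ae_mem_hypBall : ∀ᵐ x ∂(hypVolume N), x ∈ hypBall N :=
  (withDensity_absolutelyContinuous _ _).ae_le (ae_restrict_mem measurableSet_hypBall)

theorem toReal_density_ae_eq : ∀ᵐ x ∂(volume.restrict (hypBall N)),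
    (ENNReal.ofReal ((2 / (1 - ‖x‖ ^ 2)) ^ N)).toReal = confFactor x ^ N := by
  filter_upwards [ae_restrict_mem measurableSet_hypBall] with x hx
  exact ENNReal.toReal_ofReal (pow_nonneg (confFactor_pos hx).le N)

theorem measurable_density : Measurable fun x : EuclideanSpace ℝ (Fin N) =>
    ENNReal.ofReal ((2 / (1 - ‖x‖ ^ 2)) ^ N) :=
  (measurable_confFactor.pow_const N).ennreal_ofReal

theorem integrable_hypVolume_iff {f : EuclideanSpace ℝ (Fin N) → ℝ} :
    Integrable f (hypVolume N) ↔
      Integrable (fun x => confFactor x ^ N * f x) (volume.restrict (hypBall N)) := by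
  rw [hypVolume, integrable_withDensity_iff_integrable_smul' measurable_density
    (Filter.Eventually.of_forall fun _ => ENNReal.ofReal_lt_top)]
  refine integrable_congr ?_
  filter_upwards [toReal_density_ae_eq] with x hx
  rw [hx, smul_eq_mul]

theorem integral_hypVolume_eq (f : EuclideanSpace ℝ (Fin N) → ℝ) :
    ∫ x, f x ∂(hypVolume N) = ∫ x in hypBall N, confFactor x ^ N * f x := by
  rw [hypVolume, integral_withDensity_eq_integral_toReal_smul measurable_density
    (Filter.Eventually.of_forall fun _ => ENNReal.ofReal_lt_top)]
  refine integral_congr_ae ?_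
  filter_upwards [toReal_density_ae_eq] with x hx
  rw [hx, smul_eq_mul]

theorem IsHypTestFunction.integrable_of_continuousAt (hu : IsHypTestFunction u)
    {f : EuclideanSpace ℝ (Fin N) → ℝ} (hf : ∀ x ∈ hypBall N, ContinuousAt f x)
    (h0 : ∀ x, x ∉ tsupport u → f x = 0) : Integrable f (hypVolume N) := by
  rw [integrable_hypVolume_iff]
  refine Integrable.restrict (Continuous.integrable_of_hasCompactSupport ?_ ?_)
  · refine continuous_iff_continuousAt.2 fun x => ?_
    by_cases hx : x ∈ hypBall N
    · exact ((contDiffAt_confFactor hx).continuousAt.pow N).mul (hf x hx)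
    · refine (continuousAt_const (y := (0 : ℝ))).congr ?_
      have hx' : x ∈ (tsupport u)ᶜ := fun h => hx (hu.support_subset h)
      filter_upwards [(isClosed_tsupport u).isOpen_compl.mem_nhds hx'] with z hz
      rw [h0 z hz, mul_zero]
  · exact HasCompactSupport.intro hu.compact_support fun x hx => by rw [h0 x hx, mul_zero]

theorem hypGradSq_eq {x : EuclideanSpace ℝ (Fin N)} (hx : x ∈ hypBall N) :
    hypGradSq u x = (confFactor x ^ 2)⁻¹ * ‖gradient u x‖ ^ 2 := by
  have h := one_sub_norm_sq_pos hx
  rw [hypGradSq, hypInner, hypGrad, inner_smul_left, inner_smul_right, real_inner_self_eq_norm_sq,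
    confFactor, conj_trivial]
  field_simp

theorem IsHypTestFunction.hasGradientAt (hu : IsHypTestFunction u)
    (x : EuclideanSpace ℝ (Fin N)) : HasGradientAt u (gradient u x) x :=
  (hu.smooth.differentiable (by simp) x).hasGradientAt

theorem gradient_eq_zero_of_notMem_tsupport {x : EuclideanSpace ℝ (Fin N)} (hx : x ∉ tsupport u) :
    gradient u x = 0 := by
  rw [gradient, fderiv_of_notMem_tsupport ℝ hx, map_zero]

theorem IsHypTestFunction.continuous_gradient (hu : IsHypTestFunction u) :
    Continuous (gradient u) :=
  (InnerProductSpace.toDual ℝ (EuclideanSpace ℝ (Fin N))).symm.continuous.comp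
    (hu.smooth.continuous_fderiv (by simp))

theorem IsHypTestFunction.integrable_hypGradSq (hu : IsHypTestFunction u) :
    Integrable (fun x => hypGradSq u x) (hypVolume N) := by
  refine hu.integrable_of_continuousAt (fun x hx => ?_) fun x hx => ?_
  · have h : ContinuousAt (fun x => (confFactor x ^ 2)⁻¹ * ‖gradient u x‖ ^ 2) x :=
      (((contDiffAt_confFactor hx).continuousAt.pow 2).inv₀
        (pow_pos (confFactor_pos hx) 2).ne').mul (hu.continuous_gradient.continuousAt.norm.pow 2)
    refine h.congr ?_
    filter_upwards [isOpen_hypBall.mem_nhds hx] with z hz using (hypGradSq_eq hz).symm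
  · rw [hypGradSq, hypGrad, gradient_eq_zero_of_notMem_tsupport hx]
    simp [hypInner]

theorem IsHypTestFunction.integrable_sq (hu : IsHypTestFunction u) :
    Integrable (fun x => u x ^ 2) (hypVolume N) :=
  hu.integrable_of_continuousAt (fun _ _ => (hu.smooth.continuous.pow 2).continuousAt)
    fun x hx => by rw [image_eq_zero_of_notMem_tsupport hx]; simp

variable {F : EuclideanSpace ℝ (Fin N) → EuclideanSpace ℝ (Fin N)}

theorem IsHypTestFunction.contDiff_sq_smul (hu : IsHypTestFunction u)
    (hF : ∀ x ∈ hypBall N, ContDiffAt ℝ 1 F x) : ContDiff ℝ 1 fun x => u x ^ 2 • F x := by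
  refine contDiff_iff_contDiffAt.2 fun x => ?_
  by_cases hx : x ∈ hypBall N
  · exact ((hu.smooth.of_le (by simp)).contDiffAt.pow 2).smul (hF x hx)
  · refine (contDiffAt_const (c := (0 : EuclideanSpace ℝ (Fin N)))).congr_of_eventuallyEq ?_
    have hx' : x ∈ (tsupport u)ᶜ := fun h => hx (hu.support_subset h)
    filter_upwards [(isClosed_tsupport u).isOpen_compl.mem_nhds hx'] with z hz
    rw [image_eq_zero_of_notMem_tsupport hz]; simp

theorem IsHypTestFunction.hasCompactSupport_sq_smul (hu : IsHypTestFunction u) :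
    HasCompactSupport fun x => u x ^ 2 • F x :=
  HasCompactSupport.intro hu.compact_support fun x hx => by
    rw [image_eq_zero_of_notMem_tsupport hx]; simp

theorem IsHypTestFunction.euclDiv_sq_smul_eq_zero {x : EuclideanSpace ℝ (Fin N)}
    (hx : x ∉ tsupport u) : euclDiv (fun x => u x ^ 2 • F x) x = 0 := by
  have h : (fun x => u x ^ 2 • F x) =ᶠ[nhds x] fun _ => 0 := by
    filter_upwards [(isClosed_tsupport u).isOpen_compl.mem_nhds hx] with z hz
    rw [image_eq_zero_of_notMem_tsupport hz]; simp
  rw [euclDiv, h.fderiv_eq]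
  simp

/-- A vector field with `div F - |F|² ≥ R` (in the hyperbolic sense) gives a majorant of `R u²` with
the same integral as the Dirichlet energy density. -/
theorem IsHypTestFunction.exists_majorant (hN : 2 ≤ N) (hu : IsHypTestFunction u)
    (hF : ∀ x ∈ hypBall N, ContDiffAt ℝ 1 F x) {R : EuclideanSpace ℝ (Fin N) → ℝ}
    (hR : ∀ x ∈ hypBall N, confFactor x ^ N * R x ≤
      euclDiv F x - (confFactor x ^ (N - 2))⁻¹ * ‖F x‖ ^ 2) :
    ∃ T : EuclideanSpace ℝ (Fin N) → ℝ, Integrable T (hypVolume N) ∧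
      ∫ x, T x ∂(hypVolume N) = ∫ x, hypGradSq u x ∂(hypVolume N) ∧
      ∀ x ∈ hypBall N, R x * u x ^ 2 ≤ T x := by
  set G := fun x => u x ^ 2 • F x with hG
  have hG1 : ContDiff ℝ 1 G := hu.contDiff_sq_smul hF
  have hG2 : HasCompactSupport G := hu.hasCompactSupport_sq_smul
  have hcancel : Set.EqOn (fun x => confFactor x ^ N * ((confFactor x ^ N)⁻¹ * euclDiv G x))
      (euclDiv G) (hypBall N) := fun x hx =>
    mul_inv_cancel_left₀ (pow_pos (confFactor_pos hx) N).ne' _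
  have hI : Integrable (fun x => (confFactor x ^ N)⁻¹ * euclDiv G x) (hypVolume N) := by
    rw [integrable_hypVolume_iff]
    exact (integrable_euclDiv hG1 hG2).integrableOn.congr_fun hcancel.symm measurableSet_hypBall
  have hI0 : ∫ x, (confFactor x ^ N)⁻¹ * euclDiv G x ∂(hypVolume N) = 0 := by
    rw [integral_hypVolume_eq, setIntegral_congr_fun measurableSet_hypBall hcancel,
      setIntegral_eq_integral_of_forall_compl_eq_zero, integral_euclDiv_eq_zero hG1 hG2]
    exact fun x hx => IsHypTestFunction.euclDiv_sq_smul_eq_zero fun h => hx (hu.support_subset h)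
  -- Adding a divergence of integral zero leaves the energy unchanged; integrability of `R u²` is
  -- not needed at this stage.
  refine ⟨fun x => hypGradSq u x + (confFactor x ^ N)⁻¹ * euclDiv G x,
    hu.integrable_hypGradSq.add hI, ?_, fun x hx => ?_⟩
  · rw [integral_add hu.integrable_hypGradSq hI, hI0, add_zero]
  have hρ := confFactor_pos hx
  have hw := pow_pos hρ (N - 2)
  have hg := HasGradientAt.comp_hasDerivAt (hasDerivAt_pow 2 (u x)) (hu.hasGradientAt x)
  have hdiv : euclDiv G x = 2 * u x * inner ℝ (gradient u x) (F x) + u x ^ 2 * euclDiv F x := by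
    rw [hG, euclDiv_smul hg ((hF x hx).differentiableAt one_ne_zero), inner_smul_left]
    simp
  -- The completed square `|∇u + uF|² ≥ 0`, in Euclidean terms.
  have hsq : 0 ≤ confFactor x ^ (N - 2) *
      ‖gradient u x + ((confFactor x ^ (N - 2))⁻¹ * u x) • F x‖ ^ 2 := by positivity
  have hexp : confFactor x ^ (N - 2) *
      ‖gradient u x + ((confFactor x ^ (N - 2))⁻¹ * u x) • F x‖ ^ 2
      = confFactor x ^ (N - 2) * ‖gradient u x‖ ^ 2 + 2 * u x * inner ℝ (gradient u x) (F x)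
        + u x ^ 2 * ((confFactor x ^ (N - 2))⁻¹ * ‖F x‖ ^ 2) := by
    rw [norm_add_sq_real, norm_smul, mul_pow, Real.norm_eq_abs, sq_abs, inner_smul_right]
    field_simp
  have hR' := mul_le_mul_of_nonneg_left (hR x hx) (sq_nonneg (u x))
  refine le_of_mul_le_mul_left ?_ (pow_pos hρ N)
  rw [mul_add, mul_inv_cancel_left₀ (pow_pos hρ N).ne', hypGradSq_eq hx, ← mul_assoc (_ ^ N) (_)⁻¹,
    confFactor_pow hN, mul_assoc (_ ^ (N - 2)) (_ ^ 2) (_)⁻¹,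
    mul_inv_cancel₀ (pow_pos hρ 2).ne', mul_one, ← confFactor_pow hN, hdiv]
  linarith

end Integration

/-! ### Bounds on the potential lost in gluing. -/

section Potential

variable {N M : ℕ} {lam d r : ℝ}

theorem constH_nonneg : 0 ≤ constH N lam := by unfold constH; positivity

theorem constD_nonneg : 0 ≤ constD N lam := by
  have := gammaN_nonneg (N := N) (lam := lam)
  unfold constD; positivity

/-- Here the lower bound on `λ` enters: `(N - 1)² - 4(N - 2) = (N - 3)²`, so `λ ≥ N - 2` gives `γ ≤
N - 3`. -/
theorem constC_nonneg (hN : 3 ≤ N) (hlam : (N : ℝ) - 2 ≤ lam) : 0 ≤ constC N lam := by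
  have hN' : (3 : ℝ) ≤ N := by exact_mod_cast hN
  have h0 := gammaN_nonneg (N := N) (lam := lam)
  have h1 : gammaN N lam ≤ (N : ℝ) - 3 := Real.sqrt_le_iff.2 ⟨by linarith, by nlinarith⟩
  exact div_nonneg (mul_nonneg (by linarith) (by linarith)) (by norm_num)

theorem radialPot_nonneg (hN : 3 ≤ N) (hlam : (N : ℝ) - 2 ≤ lam) (hr : 0 < r) :
    0 ≤ radialPot N lam r :=
  add_nonneg (add_nonneg (mul_nonneg constH_nonneg (by positivity))
    (mul_nonneg (constC_nonneg hN hlam) (by positivity)))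
    (mul_nonneg constD_nonneg (gFun_nonneg hr))

theorem one_div_sinh_sq_le {s : ℝ} (hs : 0 < s) (hsr : s ≤ r) :
    1 / Real.sinh r ^ 2 ≤ 1 / Real.sinh s ^ 2 := by
  have h := Real.sinh_pos_iff.2 hs
  exact one_div_le_one_div_of_le (by positivity)
    (pow_le_pow_left₀ h.le (Real.sinh_le_sinh.2 hsr) 2)

theorem constK_nonneg (hN : 3 ≤ N) (hlam : (N : ℝ) - 2 ≤ lam) (hd : 0 < d) :
    0 ≤ constK N lam d :=
  add_nonneg (add_nonneg (mul_nonneg constH_nonneg (by positivity))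
    (mul_nonneg (constC_nonneg hN hlam) (by positivity)))
    (mul_nonneg constD_nonneg (gFun_nonneg (half_pos hd)))

theorem radialPot_le_constK (hN : 3 ≤ N) (hlam : (N : ℝ) - 2 ≤ lam) (hd : 0 < d) (hr : d ≤ r) :
    radialPot N lam r ≤ constK N lam d := by
  have h2 : 0 < d / 2 := half_pos hd
  have h3 : d / 2 ≤ r := by linarith
  refine add_le_add (add_le_add (mul_le_mul_of_nonneg_left ?_ constH_nonneg)
    (mul_le_mul_of_nonneg_left (one_div_sinh_sq_le h2 h3) (constC_nonneg hN hlam)))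
    (mul_le_mul_of_nonneg_left (antitoneOn_gFun h2 (h2.trans_le h3) h3) constD_nonneg)
  exact one_div_le_one_div_of_le (by positivity) (pow_le_pow_left₀ hd.le hr 2)

/-- The factor `1 - p` vanishes for `r ≤ d/2`, so the decreasing functions `1/sinh²` and `g` are
bounded by their values at `d/2`. The `1/r²` term does better, giving `2/d²` through `1 - p ≤
2(r/d)²`. This explains the mixed arguments `d` and `d/2` in `constK`. -/
theorem one_sub_sinCutoff_mul_radialPot_le (hN : 3 ≤ N) (hlam : (N : ℝ) - 2 ≤ lam) (hd : 0 < d)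
    (hr : 0 < r) : (1 - sinCutoff (r / d)) * radialPot N lam r ≤ 2 * constK N lam d := by
  have h2 : 0 < d / 2 := half_pos hd
  rcases le_or_gt r (d / 2) with h | h
  · rw [sinCutoff_of_le, sub_self, zero_mul]
    · exact mul_nonneg two_pos.le (constK_nonneg hN hlam hd)
    · rw [div_le_div_iff₀ hd two_pos]; linarith
  have q0 : 0 ≤ 1 - sinCutoff (r / d) := sub_nonneg.2 (sinCutoff_le_one _)
  have q1 : 1 - sinCutoff (r / d) ≤ 2 := by linarith [sinCutoff_nonneg (r / d)]
  have hA : (1 - sinCutoff (r / d)) * (1 / r ^ 2) ≤ 2 * (1 / d ^ 2) := by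
    calc _ ≤ 2 * (r / d) ^ 2 * (1 / r ^ 2) :=
          mul_le_mul_of_nonneg_right (one_sub_sinCutoff_le _) (by positivity)
      _ = _ := by field_simp
  have hB : (1 - sinCutoff (r / d)) * (1 / Real.sinh r ^ 2) ≤ 2 * (1 / Real.sinh (d / 2) ^ 2) :=
    mul_le_mul q1 (one_div_sinh_sq_le h2 h.le) (by positivity) two_pos.le
  have hC : (1 - sinCutoff (r / d)) * gFun r ≤ 2 * gFun (d / 2) :=
    mul_le_mul q1 (antitoneOn_gFun h2 hr h.le) (gFun_nonneg hr) two_pos.le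
  have hA' := mul_le_mul_of_nonneg_left hA (constH_nonneg (N := N) (lam := lam))
  have hB' := mul_le_mul_of_nonneg_left hB (constC_nonneg hN hlam)
  have hC' := mul_le_mul_of_nonneg_left hC (constD_nonneg (N := N) (lam := lam))
  unfold radialPot constK
  linarith

variable {x : EuclideanSpace ℝ (Fin N)} {y : Fin M → EuclideanSpace ℝ (Fin N)}

theorem sum_polePart_le_one (hd : 0 < d) (hy : ∀ k, y k ∈ hypBall N)
    (hsep : ∀ j k, j ≠ k → 2 * d ≤ hypDist (y j) (y k)) (hx : x ∈ hypBall N) :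
    ∑ k, polePart d (y k) x ≤ 1 := by
  by_cases hex : ∃ k, hypDist x (y k) < d
  · obtain ⟨k, hk⟩ := hex
    rw [Finset.sum_eq_single k (fun j _ hj =>
      polePart_eq_zero hd (hypDist_ge_of_lt hy hsep hx hj hk)) (by simp)]
    exact sinCutoff_le_one _
  · push Not at hex
    rw [Finset.sum_eq_zero fun j _ => polePart_eq_zero hd (hex j)]
    exact zero_le_one

theorem sum_one_sub_polePart_mul_le (hN : 3 ≤ N) (hlam : (N : ℝ) - 2 ≤ lam) (hd : 0 < d)
    (hy : ∀ k, y k ∈ hypBall N) (hsep : ∀ j k, j ≠ k → 2 * d ≤ hypDist (y j) (y k))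
    (hx : x ∈ hypBall N) (hxy : ∀ k, x ≠ y k) :
    ∑ k, (1 - polePart d (y k) x) * potV N lam (y k) x ≤ ((M : ℝ) + 1) * constK N lam d := by
  have hK := constK_nonneg hN hlam hd
  have hfar : ∀ k, d ≤ hypDist x (y k) →
      (1 - polePart d (y k) x) * potV N lam (y k) x ≤ constK N lam d := fun k hk => by
    rw [polePart_eq_zero hd hk, sub_zero, one_mul]
    exact radialPot_le_constK hN hlam hd hk
  by_cases hex : ∃ k, hypDist x (y k) < d
  · obtain ⟨k, hk⟩ := hex
    calc ∑ j, (1 - polePart d (y j) x) * potV N lam (y j) x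
        -- The near pole contributes `2K` and the other `M - 1` poles `K` each, in total `M + 1`.
        ≤ ∑ j, (constK N lam d + if j = k then constK N lam d else 0) := by
          refine Finset.sum_le_sum fun j _ => ?_
          split_ifs with h
          · subst h
            rw [← two_mul]
            exact one_sub_sinCutoff_mul_radialPot_le hN hlam hd (hypDist_pos hx (hy j) (hxy j))
          · rw [add_zero]
            exact hfar j (hypDist_ge_of_lt hy hsep hx h hk)
      _ = ((M : ℝ) + 1) * constK N lam d := by
          rw [Finset.sum_add_distrib]
          simp
          ring
  · push Not at hex
    calc ∑ j, (1 - polePart d (y j) x) * potV N lam (y j) x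
        ≤ ∑ _j : Fin M, constK N lam d := Finset.sum_le_sum fun j _ => hfar j (hex j)
      _ ≤ ((M : ℝ) + 1) * constK N lam d := by simp; linarith

end Potential

/-! ### Removing the truncation. -/

section Limit

variable {N M : ℕ} {lam d ε : ℝ} {x : EuclideanSpace ℝ (Fin N)}
  {y : Fin M → EuclideanSpace ℝ (Fin N)}

theorem measurable_hypDist (y : EuclideanSpace ℝ (Fin N)) : Measurable fun x => hypDist x y := by
  unfold hypDist Real.arcosh
  fun_prop

theorem measurable_potV (y : EuclideanSpace ℝ (Fin N)) : Measurable (potV N lam y) := by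
  have h := measurable_hypDist y
  have hs : Measurable fun x => Real.sinh (hypDist x y) := Real.measurable_sinh.comp h
  have hc : Measurable fun x => Real.cosh (hypDist x y) := Real.measurable_cosh.comp h
  unfold potV gFun
  fun_prop

theorem measurable_polePot (y : EuclideanSpace ℝ (Fin N)) : Measurable (polePot lam ε y) :=
  ((contDiff_poleCutoff ε).continuous.measurable.comp (measurable_hypDist y)).mul
    ((measurable_potV y).const_add lam)

theorem measurable_polePart (y : EuclideanSpace ℝ (Fin N)) : Measurable (polePart d y) :=
  contDiff_sinCutoff.continuous.measurable.comp ((measurable_hypDist y).div_const d)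

theorem measurable_multiLower (k₁ : Fin M) : Measurable (multiLower lam d ε y k₁) := by
  unfold multiLower
  exact (measurable_polePot _).add (Finset.measurable_fun_sum _ fun k _ =>
    (measurable_polePart _).mul ((measurable_polePot _).sub (measurable_polePot _)))

theorem polePot_nonneg {y : EuclideanSpace ℝ (Fin N)} (hN : 3 ≤ N) (hlam : (N : ℝ) - 2 ≤ lam)
    (hy : y ∈ hypBall N) (hx : x ∈ hypBall N) (hxy : x ≠ y) : 0 ≤ polePot lam ε y x := by
  have hN' : (3 : ℝ) ≤ N := by exact_mod_cast hN
  have h : 0 ≤ potV N lam y x := radialPot_nonneg hN hlam (hypDist_pos hx hy hxy)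
  exact mul_nonneg (poleCutoff_nonneg _ _) (by linarith)

theorem multiLower_nonneg (hN : 3 ≤ N) (hlam : (N : ℝ) - 2 ≤ lam) (hd : 0 < d)
    (hy : ∀ k, y k ∈ hypBall N) (hsep : ∀ j k, j ≠ k → 2 * d ≤ hypDist (y j) (y k))
    (k₁ : Fin M) (hx : x ∈ hypBall N) (hxy : ∀ k, x ≠ y k) :
    0 ≤ multiLower lam d ε y k₁ x := by
  -- In this form all weights are nonnegative, because the cutoffs sum to at most `1`.
  have h1 : multiLower lam d ε y k₁ x = (1 - ∑ k, polePart d (y k) x) * polePot lam ε (y k₁) x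
      + ∑ k, polePart d (y k) x * polePot lam ε (y k) x := by
    unfold multiLower
    simp only [mul_sub, Finset.sum_sub_distrib, ← Finset.sum_mul]
    ring
  rw [h1]
  exact add_nonneg (mul_nonneg (sub_nonneg.2 (sum_polePart_le_one hd hy hsep hx))
    (polePot_nonneg hN hlam (hy k₁) hx (hxy k₁))) (Finset.sum_nonneg fun k _ =>
      mul_nonneg (sinCutoff_nonneg _) (polePot_nonneg hN hlam (hy k) hx (hxy k)))

/-- The untruncated lower bound. -/
noncomputable def limitLower (lam d : ℝ) (y : Fin M → EuclideanSpace ℝ (Fin N)) (k₁ : Fin M)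
    (x : EuclideanSpace ℝ (Fin N)) : ℝ :=
  (lam + potV N lam (y k₁) x)
    + ∑ k, polePart d (y k) x * (potV N lam (y k) x - potV N lam (y k₁) x)

theorem measurable_limitLower (k₁ : Fin M) : Measurable (limitLower lam d y k₁) := by
  unfold limitLower
  exact ((measurable_potV _).const_add lam).add (Finset.measurable_fun_sum _ fun k _ =>
    (measurable_polePart _).mul ((measurable_potV _).sub (measurable_potV _)))

theorem polePot_eq_of_le {y : EuclideanSpace ℝ (Fin N)} (hε : 0 < ε) (h : 2 * ε ≤ hypDist x y) :
    polePot lam ε y x = lam + potV N lam y x := by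
  rw [polePot, poleCutoff_of_ge hε h, one_mul]

theorem multiLower_eq_limitLower (hε : 0 < ε) (k₁ : Fin M) (h : ∀ k, 2 * ε ≤ hypDist x (y k)) :
    multiLower lam d ε y k₁ x = limitLower lam d y k₁ x := by
  simp only [multiLower, limitLower, polePot_eq_of_le hε (h _), add_sub_add_left_eq_sub]

theorem eventually_multiLower_eq (hy : ∀ k, y k ∈ hypBall N) (k₁ : Fin M) (hx : x ∈ hypBall N)
    (hxy : ∀ k, x ≠ y k) : ∀ᶠ n : ℕ in Filter.atTop,
      multiLower lam d (1 / ((n : ℝ) + 1)) y k₁ x = limitLower lam d y k₁ x := by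
  have h : ∀ᶠ n : ℕ in Filter.atTop, ∀ k, 1 / ((n : ℝ) + 1) < hypDist x (y k) / 2 := by
    refine Filter.eventually_all.2 fun k => ?_
    exact tendsto_one_div_add_atTop_nhds_zero_nat.eventually_lt_const
      (half_pos (hypDist_pos hx (hy k) (hxy k)))
  filter_upwards [h] with n hn
  exact multiLower_eq_limitLower (by positivity) k₁ fun k => by linarith [hn k]

/-- The untruncated bound equals `λ + (1 - ∑ p_k) V_{k₁} + ∑ p_k V_k`. The nonnegative middle term
is discarded, and the missing `∑ (1 - p_k) V_k` is paid for by `(M + 1) K`. -/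
theorem sum_potV_le_limitLower (hN : 3 ≤ N) (hlam : (N : ℝ) - 2 ≤ lam) (hd : 0 < d)
    (hy : ∀ k, y k ∈ hypBall N) (hsep : ∀ j k, j ≠ k → 2 * d ≤ hypDist (y j) (y k))
    (k₁ : Fin M) (hx : x ∈ hypBall N) (hxy : ∀ k, x ≠ y k) :
    multiPotV N lam y x ≤ limitLower lam d y k₁ x + (((M : ℝ) + 1) * constK N lam d - lam) := by
  have h1 := sum_one_sub_polePart_mul_le hN hlam hd hy hsep hx hxy
  have h2 : 0 ≤ (1 - ∑ k, polePart d (y k) x) * potV N lam (y k₁) x :=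
    mul_nonneg (sub_nonneg.2 (sum_polePart_le_one hd hy hsep hx))
      (radialPot_nonneg hN hlam (hypDist_pos hx (hy k₁) (hxy k₁)))
  unfold multiPotV limitLower
  simp only [sub_mul, one_mul, mul_sub, Finset.sum_sub_distrib, ← Finset.sum_mul] at h1 h2 ⊢
  linarith

theorem multiPotV_nonneg (hN : 3 ≤ N) (hlam : (N : ℝ) - 2 ≤ lam) (hy : ∀ k, y k ∈ hypBall N)
    (hx : x ∈ hypBall N) (hxy : ∀ k, x ≠ y k) : 0 ≤ multiPotV N lam y x :=
  Finset.sum_nonneg fun k _ => radialPot_nonneg hN hlam (hypDist_pos hx (hy k) (hxy k))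

theorem ae_ne_pole (hN : 1 ≤ N) (y : Fin M → EuclideanSpace ℝ (Fin N)) :
    ∀ᵐ x ∂(hypVolume N), ∀ k, x ≠ y k := by
  have : Nonempty (Fin N) := ⟨⟨0, hN⟩⟩
  have h : hypVolume N ≪ volume :=
    (withDensity_absolutelyContinuous _ _).trans Measure.restrict_le_self.absolutelyContinuous
  refine ae_all_iff.2 fun k => h.ae_le ?_
  exact Measure.ae_ne volume (y k)

variable {u : EuclideanSpace ℝ (Fin N) → ℝ}

/-- The bound does not depend on `ε`, and is phrased with the lower integral so that Fatou's lemma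
applies to it. -/
theorem IsHypTestFunction.lintegral_multiLower_le (hN : 3 ≤ N) (hlam₁ : (N : ℝ) - 2 ≤ lam)
    (hlam₂ : lam ≤ (((N : ℝ) - 1) / 2) ^ 2) (hd : 0 < d) (hε : 0 < ε) (hy : ∀ k, y k ∈ hypBall N)
    (hsep : ∀ j k, j ≠ k → 2 * d ≤ hypDist (y j) (y k)) (k₁ : Fin M)
    (hu : IsHypTestFunction u) :
    ∫⁻ x, ENNReal.ofReal (multiLower lam d ε y k₁ x * u x ^ 2) ∂(hypVolume N) ≤
      ENNReal.ofReal ((∫ x, hypGradSq u x ∂(hypVolume N))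
        + Real.pi ^ 2 / d ^ 2 * ∫ x, u x ^ 2 ∂(hypVolume N)) := by
  obtain ⟨T, hT, hT0, hTle⟩ := hu.exists_majorant (by omega)
    (fun x hx => contDiffAt_multiFlux (lam := lam) hd hε hy k₁ hx)
    (fun x hx => multiLower_le_euclDiv hN hlam₂ hd hε hy hsep k₁ hx)
  have hu2 := hu.integrable_sq.const_mul (Real.pi ^ 2 / d ^ 2)
  have hsum : Integrable (fun x => T x + Real.pi ^ 2 / d ^ 2 * u x ^ 2) (hypVolume N) :=
    hT.add hu2
  have hle : ∀ᵐ x ∂(hypVolume N),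
      multiLower lam d ε y k₁ x * u x ^ 2 ≤ T x + Real.pi ^ 2 / d ^ 2 * u x ^ 2 := by
    filter_upwards [ae_mem_hypBall] with x hx
    linarith [hTle x hx]
  rw [← hT0, ← integral_const_mul, ← integral_add hT hu2,
    ofReal_integral_eq_lintegral_ofReal hsum]
  · exact lintegral_mono_ae (hle.mono fun x hx => ENNReal.ofReal_le_ofReal hx)
  · filter_upwards [hle, ae_mem_hypBall, ae_ne_pole (by omega) y] with x h1 hx hxy
    exact (mul_nonneg (multiLower_nonneg hN hlam₁ hd hy hsep k₁ hx hxy) (sq_nonneg _)).trans h1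

/-- Off the null set of poles the truncated bounds are eventually equal to the limit, so Fatou's
lemma gives the estimate. -/
theorem IsHypTestFunction.lintegral_limitLower_le (hN : 3 ≤ N) (hlam₁ : (N : ℝ) - 2 ≤ lam)
    (hlam₂ : lam ≤ (((N : ℝ) - 1) / 2) ^ 2) (hd : 0 < d) (hy : ∀ k, y k ∈ hypBall N)
    (hsep : ∀ j k, j ≠ k → 2 * d ≤ hypDist (y j) (y k)) (k₁ : Fin M)
    (hu : IsHypTestFunction u) :
    ∫⁻ x, ENNReal.ofReal (limitLower lam d y k₁ x * u x ^ 2) ∂(hypVolume N) ≤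
      ENNReal.ofReal ((∫ x, hypGradSq u x ∂(hypVolume N))
        + Real.pi ^ 2 / d ^ 2 * ∫ x, u x ^ 2 ∂(hypVolume N)) := by
  have hm : ∀ n : ℕ, Measurable fun x =>
      ENNReal.ofReal (multiLower lam d (1 / ((n : ℝ) + 1)) y k₁ x * u x ^ 2) := fun n =>
    ((measurable_multiLower k₁).mul (hu.smooth.continuous.measurable.pow_const 2)).ennreal_ofReal
  calc _ = ∫⁻ x, Filter.liminf (fun n : ℕ =>
        ENNReal.ofReal (multiLower lam d (1 / ((n : ℝ) + 1)) y k₁ x * u x ^ 2)) Filter.atTop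
          ∂(hypVolume N) := by
        refine lintegral_congr_ae ?_
        filter_upwards [ae_mem_hypBall, ae_ne_pole (by omega) y] with x hx hxy
        refine (Filter.Tendsto.liminf_eq (tendsto_const_nhds.congr' ?_)).symm
        filter_upwards [eventually_multiLower_eq hy k₁ hx hxy] with n hn
        rw [hn]
    _ ≤ Filter.liminf (fun n : ℕ => ∫⁻ x, ENNReal.ofReal
          (multiLower lam d (1 / ((n : ℝ) + 1)) y k₁ x * u x ^ 2) ∂(hypVolume N)) Filter.atTop :=
        lintegral_liminf_le hm
    _ ≤ Filter.liminf (fun _ : ℕ => ENNReal.ofReal ((∫ x, hypGradSq u x ∂(hypVolume N))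
          + Real.pi ^ 2 / d ^ 2 * ∫ x, u x ^ 2 ∂(hypVolume N))) Filter.atTop :=
        Filter.liminf_le_liminf (Filter.Eventually.of_forall fun n =>
          hu.lintegral_multiLower_le hN hlam₁ hlam₂ hd (by positivity) hy hsep k₁)
    _ = _ := Filter.liminf_const _

theorem limitLower_nonneg (hN : 3 ≤ N) (hlam : (N : ℝ) - 2 ≤ lam) (hd : 0 < d)
    (hy : ∀ k, y k ∈ hypBall N) (hsep : ∀ j k, j ≠ k → 2 * d ≤ hypDist (y j) (y k))
    (k₁ : Fin M) (hx : x ∈ hypBall N) (hxy : ∀ k, x ≠ y k) : 0 ≤ limitLower lam d y k₁ x := by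
  obtain ⟨n, hn⟩ := (eventually_multiLower_eq (lam := lam) (d := d) hy k₁ hx hxy).exists
  rw [← hn]
  exact multiLower_nonneg hN hlam hd hy hsep k₁ hx hxy

theorem two_mul_halfMinDist_le {j k : Fin M} (hjk : j ≠ k) :
    2 * halfMinDist y ≤ hypDist (y j) (y k) := by
  have h : halfMinDist y ≤ hypDist (y j) (y k) / 2 :=
    ciInf_le (f := fun p : {p : Fin M × Fin M // p.1 ≠ p.2} => hypDist (y p.1.1) (y p.1.2) / 2)
      (Set.finite_range _).bddBelow ⟨(j, k), hjk⟩
  linarith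

theorem halfMinDist_pos (hM : 2 ≤ M) (hy : ∀ k, y k ∈ hypBall N) (hinj : Function.Injective y) :
    0 < halfMinDist y := by
  have : Nonempty {p : Fin M × Fin M // p.1 ≠ p.2} :=
    ⟨⟨(⟨0, by omega⟩, ⟨1, by omega⟩), by simp⟩⟩
  obtain ⟨p, hp⟩ := exists_eq_ciInf_of_finite
    (f := fun p : {p : Fin M × Fin M // p.1 ≠ p.2} => hypDist (y p.1.1) (y p.1.2) / 2)
  rw [halfMinDist, ← hp]
  exact half_pos (hypDist_pos (hy _) (hy _) (hinj.ne p.2))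

end Limit

/-! ### The multipolar inequality. -/

theorem theorem2p2 (N M : ℕ) (hN : 3 ≤ N) (hM : 2 ≤ M)
    (y : Fin M → EuclideanSpace ℝ (Fin N)) (hy : ∀ k, y k ∈ hypBall N)
    (hinj : Function.Injective y)
    (lam : ℝ) (hlam₁ : (N : ℝ) - 2 ≤ lam) (hlam₂ : lam ≤ (((N : ℝ) - 1) / 2) ^ 2)
    (u : EuclideanSpace ℝ (Fin N) → ℝ) (hu : IsHypTestFunction u) :
    Integrable (fun x => hypGradSq u x) (hypVolume N) ∧
    Integrable (fun x => u x ^ 2) (hypVolume N) ∧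
    Integrable (fun x => multiPotV N lam y x * u x ^ 2) (hypVolume N) ∧
    (∫ x, hypGradSq u x ∂(hypVolume N))
        + (Real.pi ^ 2 / halfMinDist y ^ 2 + ((M : ℝ) + 1) * constK N lam (halfMinDist y) - lam)
          * (∫ x, u x ^ 2 ∂(hypVolume N))
      ≥ ∫ x, multiPotV N lam y x * u x ^ 2 ∂(hypVolume N) := by
  have hd := halfMinDist_pos hM hy hinj
  have hsep : ∀ j k, j ≠ k → 2 * halfMinDist y ≤ hypDist (y j) (y k) := fun j k hjk =>
    two_mul_halfMinDist_le hjk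
  set d := halfMinDist y
  -- Any pole can serve as the reference away from all the poles.
  have k₁ : Fin M := ⟨0, by omega⟩
  have hG := hu.integrable_hypGradSq
  have hU := hu.integrable_sq
  have humeas : Measurable fun x => u x ^ 2 := hu.smooth.continuous.measurable.pow_const 2
  have hae : ∀ᵐ x ∂(hypVolume N), x ∈ hypBall N ∧ ∀ k, x ≠ y k :=
    ae_mem_hypBall.and (ae_ne_pole (by omega) y)
  have hL0 : 0 ≤ᵐ[hypVolume N] fun x => limitLower lam d y k₁ x * u x ^ 2 :=
    hae.mono fun x hx => mul_nonneg (limitLower_nonneg hN hlam₁ hd hy hsep k₁ hx.1 hx.2)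
      (sq_nonneg _)
  have hLm : AEStronglyMeasurable (fun x => limitLower lam d y k₁ x * u x ^ 2) (hypVolume N) :=
    ((measurable_limitLower k₁).mul humeas).aestronglyMeasurable
  have hLle := hu.lintegral_limitLower_le hN hlam₁ hlam₂ hd hy hsep k₁
  -- Integrability comes out of the Fatou bound, and by domination it passes to the singular
  -- potential.
  have hL : Integrable (fun x => limitLower lam d y k₁ x * u x ^ 2) (hypVolume N) :=
    ⟨hLm, (hasFiniteIntegral_iff_ofReal hL0).2 (hLle.trans_lt ENNReal.ofReal_lt_top)⟩
  have hE : 0 ≤ (∫ x, hypGradSq u x ∂(hypVolume N))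
      + Real.pi ^ 2 / d ^ 2 * ∫ x, u x ^ 2 ∂(hypVolume N) := by
    refine add_nonneg (integral_nonneg fun x => ?_)
      (mul_nonneg (by positivity) (integral_nonneg fun x => sq_nonneg _))
    rw [hypGradSq, hypInner]
    exact mul_nonneg (sq_nonneg _) real_inner_self_nonneg
  have hLint : ∫ x, limitLower lam d y k₁ x * u x ^ 2 ∂(hypVolume N) ≤
      (∫ x, hypGradSq u x ∂(hypVolume N))
        + Real.pi ^ 2 / d ^ 2 * ∫ x, u x ^ 2 ∂(hypVolume N) := by
    rw [← ofReal_integral_eq_lintegral_ofReal hL hL0] at hLle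
    exact (ENNReal.ofReal_le_ofReal_iff hE).1 hLle
  have hle : ∀ᵐ x ∂(hypVolume N), multiPotV N lam y x * u x ^ 2 ≤
      limitLower lam d y k₁ x * u x ^ 2 + (((M : ℝ) + 1) * constK N lam d - lam) * u x ^ 2 :=
    hae.mono fun x hx => by
      rw [← add_mul]
      exact mul_le_mul_of_nonneg_right
        (sum_potV_le_limitLower hN hlam₁ hd hy hsep k₁ hx.1 hx.2) (sq_nonneg _)
  have hR := hL.add (hU.const_mul (((M : ℝ) + 1) * constK N lam d - lam))
  have hVm : Measurable (multiPotV N lam y) := by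
    unfold multiPotV
    exact Finset.measurable_fun_sum _ fun k _ => measurable_potV (y k)
  have hV : Integrable (fun x => multiPotV N lam y x * u x ^ 2) (hypVolume N) := by
    refine hR.mono' (hVm.mul humeas).aestronglyMeasurable ?_
    filter_upwards [hle, hae] with x h1 hx
    rw [Real.norm_of_nonneg (mul_nonneg (multiPotV_nonneg hN hlam₁ hy hx.1 hx.2) (sq_nonneg _))]
    exact h1
  refine ⟨hG, hU, hV, ?_⟩
  have hfin := integral_mono_ae hV hR hle
  simp only [Pi.add_apply] at hfin
  rw [integral_add hL (hU.const_mul _), integral_const_mul] at hfin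
  linarith
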